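/- Let $n\ge 1$. For a convex body $\Omega\subset\mathbb R^{n+1}$ (compact, convex, non-empty) and $z_0\in\Omega$ let $u_{z_0}(x)=\max_{z\in\Omega}\langle x,z-z_0\rangle$, $x\in\mathbb S^n$, be its support function with respect to $z_0$, and define the entropy $$\mathcal E(\Omega)=\sup\Big\{\frac1{\omega_n}\int_{\mathbb S^n}\log u_{z_0}\,d\theta \;:\; z_0\in\Omega,\ u_{z_0}>0\text{ on }\mathbb S^n\Big\},$$ where $d\theta$ is the surface measure of $\mathbb S^n$ and $\omega_n$ the area of $\mathbb S^n$. If $M=\partial\Omega$ is smooth with Gauss curvature $K>0$ (the determinant of the Weingarten map $W=d\nu$, $\nu$ the outer unit normal) and surface measure $d\sigma$, Chow's entropy is $$\mathcal E_C(\Omega)=\frac1{\omega_n}\int_{M}K\log K\,d\sigma .$$ Let $0<T\le\infty$ and let $\{\Omega_t\}_{t\in[0,T)}$ be convex bodies in $\mathbb R^{n+1}$ evolving by the normalized Gauss curvature flow: the support function $u(x,t)=\max_{z\in\Omega_t}\langle x,z\rangle$ is smooth on $\mathbb S^n\times[0,T)$, the tensor $A_u=\bar g^{ik}(\bar\nabla_k\bar\nabla_j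 u+u\,\bar g_{kj})$ is positive definite (with $\bar g$ the standard metric of $\mathbb S^n$ and $\bar\nabla$ its covariant derivative), and $$\frac{\partial u}{\partial t}=u-\frac1{\det(A_u)}\quad\text{on }\mathbb S^n\times[0,T).$$ Assume the volume of $\Omega_0$ equals that of the unit ball of $\mathbb R^{n+1}$. Then $t\mapsto\mathcal E(\Omega_t)$ is non-increasing on $[0,T)$. Moreover, for all $t_1\le t_0$ in $[0,T)$, the function $t\mapsto\mathcal E(\Omega_t)-\mathcal E_C(\Omega_t)$ is integrable on $[t_1,t_0]$ and $$\mathcal E(\Omega_{t_0})-\mathcal E(\Omega_{t_1})\le\int_{t_1}^{t_0}\big(\mathcal E(\Omega_t)-\mathcal E_C(\Omega_t)\big)\,dt\le 0 .$$ -/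

import Mathlib

open MeasureTheory Set
open scoped InnerProductSpace ContDiff

noncomputable section

namespace GaussFlow

/-- The ambient Euclidean space `ℝ^{n+1}`. -/
abbrev Space (n : ℕ) : Type := EuclideanSpace ℝ (Fin (n + 1))

/-- The unit sphere `𝕊^n ⊆ ℝ^{n+1}`. -/
abbrev unitSphere (n : ℕ) : Set (Space n) := Metric.sphere (0 : Space n) 1

/-- The standard surface measure `dθ` of `𝕊^n`. -/
abbrev sphereMeasure (n : ℕ) : Measure (unitSphere n) := (volume : Measure (Space n)).toSphere

/-- The area `ω_n` of `𝕊^n`. -/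
def sphereArea (n : ℕ) : ℝ := (sphereMeasure n).real univ

variable {n : ℕ}

/-! ### Support functions and the entropy -/

/-- The support function `u_{z₀}(x) = max_{z ∈ Ω} ⟨x, z - z₀⟩` of `Ω` with respect to `z₀`. The
formula makes sense for every vector `x`; it is the positively `1`-homogeneous extension of the
function on `𝕊^n`. -/
def supportFn (Ω : ConvexBody (Space n)) (z₀ x : Space n) : ℝ :=
  sSup ((fun z : Space n => ⟪x, z - z₀⟫_ℝ) '' (Ω : Set (Space n)))

/-- The entropy `ℰ(Ω)`: the supremum of `ω_n⁻¹ ∫_{𝕊^n} log u_{z₀} dθ` over all `z₀ ∈ Ω` whose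
support function `u_{z₀}` is positive on `𝕊^n` (that is, over the interior points of `Ω`). The
values are bounded above by `log (diam Ω)`. -/
def entropy (Ω : ConvexBody (Space n)) : ℝ :=
  sSup {e : ℝ | ∃ z₀ ∈ Ω, (∀ x ∈ unitSphere n, 0 < supportFn Ω z₀ x) ∧
    e = (sphereArea n)⁻¹ * ∫ x, Real.log (supportFn Ω z₀ (x : Space n)) ∂(sphereMeasure n)}

/-! ### The operator `A_f` of a function on the sphere -/

/-- For a unit vector `x`, the tangent space `T_x 𝕊^n`, i.e. the hyperplane `x^⊥`. -/
abbrev tangent (x : Space n) : Submodule ℝ (Space n) := (Submodule.span ℝ {x})ᗮ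

/-- The extension of `f|_{𝕊^n}` to `ℝ^{n+1} ∖ {0}` that is constant along rays. -/
def radialExt (f : Space n → ℝ) (y : Space n) : ℝ := f (‖y‖⁻¹ • y)

/-- The Riemannian gradient on `𝕊^n` of `f|_{𝕊^n}`. (The extension `radialExt f` has no radial
derivative, so its Euclidean gradient at a point of the sphere is tangent to the sphere.) -/
def sphereGrad (f : Space n → ℝ) : Space n → Space n := gradient (radialExt f)

/-- The covariant Hessian on `𝕊^n` of `f|_{𝕊^n}` at `x`, as an endomorphism of `T_x 𝕊^n`:
`v ↦ ∇̄_v ∇̄f`, the tangential part of the Euclidean derivative of the gradient field along `v`. -/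
def sphereHess (f : Space n → ℝ) (x : Space n) : tangent x →L[ℝ] tangent x :=
  (tangent x).orthogonalProjectionOnto ∘L fderiv ℝ (sphereGrad f) x ∘L (tangent x).subtypeL

/-- The endomorphism `A_f = ḡ^{ik} (∇̄_k ∇̄_j f + f ḡ_{kj})` of `T_x 𝕊^n`. -/
def opA (f : Space n → ℝ) (x : Space n) : tangent x →L[ℝ] tangent x :=
  sphereHess f x + f x • ContinuousLinearMap.id ℝ (tangent x)

/-! ### Gauss curvature and Chow's entropy -/

/-- `x` is a unit outer normal of `Ω` at `y`. -/
def IsOuterNormal (Ω : ConvexBody (Space n)) (y x : Space n) : Prop :=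
  ‖x‖ = 1 ∧ ∀ z ∈ Ω, ⟪x, z⟫_ℝ ≤ ⟪x, y⟫_ℝ

/-- The Gauss map `ν` of `M = ∂Ω`: the unit outer normal, which is unique at each boundary point
when `M` is smooth. -/
def gaussMap (Ω : ConvexBody (Space n)) (y : Space n) : Space n :=
  Classical.epsilon (IsOuterNormal Ω y)

/-- The Weingarten map `W = dν` of `M = ∂Ω` at `y`, as an endomorphism of `T_y M = ν(y)^⊥`. (Where
`ν` is differentiable along `M` and `T_y M` is the tangent space of `M`, all derivatives within `M`
agree on `T_y M`, so the choice in `fderivWithin` does not matter.) -/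
def weingarten (Ω : ConvexBody (Space n)) (y : Space n) :
    tangent (gaussMap Ω y) →L[ℝ] tangent (gaussMap Ω y) :=
  (tangent (gaussMap Ω y)).orthogonalProjectionOnto ∘L
    fderivWithin ℝ (gaussMap Ω) (frontier (Ω : Set (Space n))) y ∘L
    (tangent (gaussMap Ω y)).subtypeL

/-- The Gauss curvature `K = det W` of `M = ∂Ω`. -/
def gaussCurvature (Ω : ConvexBody (Space n)) (y : Space n) : ℝ :=
  (weingarten Ω y).det

/-- Chow's entropy `ℰ_C(Ω) = ω_n⁻¹ ∫_M K log K dσ`, where `M = ∂Ω` and the surface measure `dσ` of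
`M` is the `n`-dimensional Hausdorff measure, normalized to agree with Lebesgue measure on
`n`-dimensional Euclidean spaces. -/
def chowEntropy (Ω : ConvexBody (Space n)) : ℝ :=
  (sphereArea n)⁻¹ * ∫ y in frontier (Ω : Set (Space n)),
    gaussCurvature Ω y * Real.log (gaussCurvature Ω y) ∂(Measure.euclideanHausdorffMeasure n)

/-! ### The normalized Gauss curvature flow -/

/-- The time interval `[0, T)`, where `T = ∞` is allowed. -/
def timeInterval (T : EReal) : Set ℝ := {t : ℝ | 0 ≤ t ∧ (t : EReal) < T}

/-- `Ω_t`, `t ∈ [0, T)`, is a smooth solution of the normalized Gauss curvature flow: its support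
function `u(x, t)` with respect to the origin is smooth on `𝕊^n × [0, T)` (equivalently, its
`1`-homogeneous extension is smooth away from `x = 0`), the endomorphism `A_u` is positive definite,
and `∂u/∂t = u - 1 / det A_u`. -/
structure IsNormalizedFlow (T : EReal) (Ω : ℝ → ConvexBody (Space n)) : Prop where
  smooth : ContDiffOn ℝ ∞ (fun p : ℝ × Space n => supportFn (Ω p.1) 0 p.2)
    (timeInterval T ×ˢ {(0 : Space n)}ᶜ)
  convex : ∀ t ∈ timeInterval T, ∀ x ∈ unitSphere n, ∀ v : tangent x, v ≠ 0 →
    0 < ⟪opA (supportFn (Ω t) 0) x v, v⟫_ℝ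
  evolution : ∀ t ∈ timeInterval T, ∀ x ∈ unitSphere n,
    HasDerivWithinAt (fun s => supportFn (Ω s) 0 x)
      (supportFn (Ω t) 0 x - 1 / (opA (supportFn (Ω t) 0) x).det) (timeInterval T) t

end GaussFlow

end

namespace GaussFlow

open Filter Topology

/-! ### Support functions of convex bodies -/

section Support

variable {n : ℕ} {Ω : ConvexBody (Space n)}

/-! Write D = det A_u and let X be the gradient of the 1-homogeneous support function, so that X
parametrizes the boundary by its outer normal. The Gauss curvature at X(θ) is 1/D(θ), and X carries
D dθ to the surface measure, hence ℰ_C is the spherical average of -log D (`chowEntropy_eq`).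

Fix a time t₀ and an admissible centre z for Ω_{t₀}, and move the centre as e^{t-t₀} z. The support
function v about the moving centre solves the same equation ∂v/∂t = v - 1/D, because the linear term
it differs by is multiplied by e^{t-t₀}. So e^{-t} v is non-increasing in time, and v is positive at
all earlier times (`supportFn_moving_pos`). The derivative of the average of log v is the average of
1 - 1/(vD) ≤ log(vD), which is the average of log v minus ℰ_C, hence at most ℰ - ℰ_C. Integrating
from t₁ to t₀, bounding the value at t₁ by ℰ(Ω_{t₁}) and taking the supremum over z gives the
integral inequality (`average_log_sub_le`).

The sign of ℰ - ℰ_C comes from log(vD) ≤ vD - 1: the integral of vD is (n+1) vol Ω_t, so the average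
of log v is at most ℰ_C as soon as the volume does not exceed that of the unit ball
(`integral_log_supportFn_le`). This volume bound follows from Gronwall's inequality (`volume_le`).
No time derivative of D is used: D is frozen at time t and vol Ω_s is bounded by the integral of
v_s^{n+1} D_t / v_t^n over n+1, with equality at s = t (`volume_real_le`).

Both volume formulas rest on the map p ↦ ‖p‖ (X(p) - z), which is injective away from 0 and has
Jacobian vD in every direction. The area formula for the boundary is proved by comparing measures
locally after projection to a tangent hyperplane (`measure_boundaryPt_image`). -/

lemma bddAbove_inner_image (Ω : ConvexBody (Space n)) (z₀ x : Space n) :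
    BddAbove ((fun z : Space n => ⟪x, z - z₀⟫_ℝ) '' (Ω : Set (Space n))) :=
  (Ω.isCompact.image (by fun_prop)).bddAbove

lemma inner_le_supportFn {z : Space n} (hz : z ∈ Ω) (z₀ x : Space n) :
    ⟪x, z - z₀⟫_ℝ ≤ supportFn Ω z₀ x :=
  le_csSup (bddAbove_inner_image Ω z₀ x) ⟨z, hz, rfl⟩

lemma exists_inner_eq_supportFn (Ω : ConvexBody (Space n)) (z₀ x : Space n) :
    ∃ z ∈ Ω, ⟪x, z - z₀⟫_ℝ = supportFn Ω z₀ x := by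
  have h := (Ω.isCompact.image (f := fun z : Space n => ⟪x, z - z₀⟫_ℝ) (by fun_prop)).sSup_mem
    (Ω.nonempty.image _)
  obtain ⟨z, hz, h⟩ := h
  exact ⟨z, hz, h⟩

lemma supportFn_eq_sub (Ω : ConvexBody (Space n)) (z x : Space n) :
    supportFn Ω z x = supportFn Ω 0 x - ⟪x, z⟫_ℝ := by
  obtain ⟨p, hp, h1⟩ := exists_inner_eq_supportFn Ω z x
  obtain ⟨q, hq, h2⟩ := exists_inner_eq_supportFn Ω 0 x
  have h3 := inner_le_supportFn hq z x
  have h4 := inner_le_supportFn hp 0 x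
  simp only [inner_sub_right, inner_zero_right] at *
  linarith

lemma inner_le_supportFn_zero {z : Space n} (hz : z ∈ Ω) (x : Space n) :
    ⟪x, z⟫_ℝ ≤ supportFn Ω 0 x := by
  simpa using inner_le_supportFn hz 0 x

lemma supportFn_smul (Ω : ConvexBody (Space n)) (z x : Space n) {r : ℝ} (hr : 0 ≤ r) :
    supportFn Ω z (r • x) = r * supportFn Ω z x := by
  obtain ⟨p, hp, h1⟩ := exists_inner_eq_supportFn Ω z x
  obtain ⟨q, hq, h2⟩ := exists_inner_eq_supportFn Ω z (r • x)
  have h3 := mul_le_mul_of_nonneg_left (inner_le_supportFn hq z x) hr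
  have h4 := inner_le_supportFn hp z (r • x)
  rw [inner_smul_left] at h2 h4
  simp only [conj_trivial] at h2 h4
  rw [h1] at h4
  linarith

/-- A point outside Ω is strictly separated from it by a functional, whose normalized representing
vector violates the hypothesis. -/
lemma mem_of_forall_inner_le {y : Space n}
    (h : ∀ x ∈ unitSphere n, ⟪x, y⟫_ℝ ≤ supportFn Ω 0 x) : y ∈ Ω := by
  by_contra hy
  obtain ⟨f, u, hfu, huf⟩ := geometric_hahn_banach_closed_point Ω.convex Ω.isClosed hy
  set a := (InnerProductSpace.toDual ℝ (Space n)).symm f with ha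
  have hfa : ∀ w, f w = ⟪a, w⟫_ℝ := fun w => by simp [ha]
  obtain ⟨q, hq, h2⟩ := exists_inner_eq_supportFn Ω 0 a
  rw [sub_zero] at h2
  have ha0 : a ≠ 0 := by
    rintro h0
    have h1 := hfu q hq
    rw [hfa, h0, inner_zero_left] at h1
    rw [hfa, h0, inner_zero_left] at huf
    linarith
  have hn : 0 < ‖a‖ := norm_pos_iff.2 ha0
  have h1 := h (‖a‖⁻¹ • a) (by simp [norm_smul, hn.ne'])
  rw [supportFn_smul _ _ _ (by positivity), inner_smul_left] at h1
  simp only [conj_trivial] at h1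
  have h3 := le_of_mul_le_mul_left h1 (inv_pos.2 hn)
  have h4 := hfu q hq
  rw [hfa] at h4 huf
  linarith

lemma mem_of_supportFn_nonneg {y : Space n} (h : ∀ x ∈ unitSphere n, 0 ≤ supportFn Ω y x) :
    y ∈ Ω :=
  mem_of_forall_inner_le fun x hx => by
    have := h x hx
    rw [supportFn_eq_sub] at this
    linarith

lemma supportFn_pos_of_mem_interior {y : Space n} (hy : y ∈ interior (Ω : Set (Space n)))
    {x : Space n} (hx : x ∈ unitSphere n) : 0 < supportFn Ω y x := by
  have hx1 : ‖x‖ = 1 := by simpa using hx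
  obtain ⟨ε, hε, h⟩ := Metric.isOpen_iff.1 isOpen_interior y hy
  have h1 : y + (ε / 2) • x ∈ Ω := by
    refine interior_subset (h ?_)
    rw [Metric.mem_ball, dist_eq_norm, add_sub_cancel_left, norm_smul, hx1, Real.norm_eq_abs,
      abs_of_pos (by positivity)]
    linarith
  have h2 := inner_le_supportFn h1 y x
  rw [add_sub_cancel_left, inner_smul_right, real_inner_self_eq_norm_sq, hx1] at h2
  linarith

/-- On the compact sphere the support function about y attains a positive minimum, and the ball
around y of that radius lies in Ω. -/
lemma mem_interior_of_supportFn_pos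
    (hc : ContinuousOn (supportFn Ω 0) (unitSphere n)) {y : Space n}
    (h : ∀ x ∈ unitSphere n, 0 < supportFn Ω y x) : y ∈ interior (Ω : Set (Space n)) := by
  have hc' : ContinuousOn (supportFn Ω y) (unitSphere n) := by
    rw [show supportFn Ω y = fun x => supportFn Ω 0 x - ⟪x, y⟫_ℝ from
      funext fun x => supportFn_eq_sub Ω y x]
    exact hc.sub (by fun_prop)
  have hne : (unitSphere n).Nonempty := NormedSpace.sphere_nonempty.2 zero_le_one
  obtain ⟨x₀, hx₀, hmin⟩ := (isCompact_sphere (0 : Space n) 1).exists_isMinOn hne hc'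
  rw [mem_interior]
  refine ⟨Metric.ball y (supportFn Ω y x₀), fun w hw => ?_, Metric.isOpen_ball,
    Metric.mem_ball_self (h x₀ hx₀)⟩
  refine mem_of_forall_inner_le fun x hx => ?_
  have hx1 : ‖x‖ = 1 := by simpa using hx
  have h1 : supportFn Ω y x₀ ≤ supportFn Ω y x := hmin hx
  have h2 := real_inner_le_norm x (w - y)
  rw [hx1, one_mul, ← dist_eq_norm] at h2
  have h3 := Metric.mem_ball.1 hw
  rw [supportFn_eq_sub Ω y x] at h1
  rw [inner_sub_right] at h2
  linarith

end Support

/-! ### The support function of a smooth, strictly convex body -/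

/-- The support function is smooth and has positive definite `A`. -/
structure IsSmoothStrictlyConvex {n : ℕ} (Ω : ConvexBody (Space n)) : Prop where
  smooth : ContDiffOn ℝ ∞ (supportFn Ω 0) {0}ᶜ
  pos : ∀ x ∈ unitSphere n, ∀ v : tangent x, v ≠ 0 → 0 < ⟪opA (supportFn Ω 0) x v, v⟫_ℝ

/-- The boundary point of `Ω` with outer normal direction `y`, if the support function is smooth. -/
noncomputable def boundaryPt {n : ℕ} (Ω : ConvexBody (Space n)) : Space n → Space n :=
  gradient (supportFn Ω 0)

/-- The derivative of `boundaryPt`, i.e. the Euclidean Hessian of the support function. -/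
noncomputable def boundaryDeriv {n : ℕ} (Ω : ConvexBody (Space n)) (y : Space n) : Space n →L[ℝ] Space n :=
  fderiv ℝ (boundaryPt Ω) y

lemma ne_zero_of_mem_unitSphere {n : ℕ} {x : Space n} (hx : x ∈ unitSphere n) : x ≠ 0 := by
  rintro rfl
  simp at hx

lemma norm_of_mem_unitSphere {n : ℕ} {x : Space n} (hx : x ∈ unitSphere n) : ‖x‖ = 1 := by
  simpa using hx

lemma normalize_mem_unitSphere {n : ℕ} {y : Space n} (hy : y ≠ 0) : ‖y‖⁻¹ • y ∈ unitSphere n := by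
  simp [norm_smul, norm_ne_zero_iff.2 hy]

namespace IsSmoothStrictlyConvex

variable {n : ℕ} {Ω : ConvexBody (Space n)} (h : IsSmoothStrictlyConvex Ω)
include h

lemma contDiffAt {y : Space n} (hy : y ≠ 0) : ContDiffAt ℝ ∞ (supportFn Ω 0) y :=
  h.smooth.contDiffAt (isOpen_compl_singleton.mem_nhds hy)

lemma continuousOn_sphere : ContinuousOn (supportFn Ω 0) (unitSphere n) :=
  h.smooth.continuousOn.mono fun _ hx => ne_zero_of_mem_unitSphere hx

lemma hasFDerivAt {y : Space n} (hy : y ≠ 0) :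
    HasFDerivAt (supportFn Ω 0) (innerSL ℝ (boundaryPt Ω y)) y := by
  have h1 := ((h.contDiffAt hy).differentiableAt (by simp)).hasGradientAt
  exact h1.hasFDerivAt

lemma contDiffOn_boundaryPt : ContDiffOn ℝ ∞ (boundaryPt Ω) {0}ᶜ := by
  have h1 : ContDiffOn ℝ ∞ (fderiv ℝ (supportFn Ω 0)) {0}ᶜ :=
    h.smooth.fderiv_of_isOpen isOpen_compl_singleton (by simp)
  exact (InnerProductSpace.toDual ℝ (Space n)).symm.contDiff.comp_contDiffOn h1

lemma contDiffAt_boundaryPt {y : Space n} (hy : y ≠ 0) : ContDiffAt ℝ ∞ (boundaryPt Ω) y :=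
  h.contDiffOn_boundaryPt.contDiffAt (isOpen_compl_singleton.mem_nhds hy)

lemma hasStrictFDerivAt_boundaryPt {y : Space n} (hy : y ≠ 0) :
    HasStrictFDerivAt (boundaryPt Ω) (boundaryDeriv Ω y) y :=
  (h.contDiffAt_boundaryPt hy).hasStrictFDerivAt (by simp)

lemma hasFDerivAt_boundaryPt {y : Space n} (hy : y ≠ 0) :
    HasFDerivAt (boundaryPt Ω) (boundaryDeriv Ω y) y :=
  (h.hasStrictFDerivAt_boundaryPt hy).hasFDerivAt

lemma continuousOn_boundaryDeriv : ContinuousOn (boundaryDeriv Ω) {0}ᶜ :=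
  h.contDiffOn_boundaryPt.continuousOn_fderiv_of_isOpen isOpen_compl_singleton (by simp)

/-- The function p ↦ u(p) - ⟨w, p⟩ is non-negative and vanishes at y, so y is a minimum and the
gradient of u there is w. Thus the support point in each direction is unique. -/
lemma eq_boundaryPt {y w : Space n} (hy : y ≠ 0) (hw : w ∈ Ω)
    (hyw : ⟪y, w⟫_ℝ = supportFn Ω 0 y) : w = boundaryPt Ω y := by
  have hd : HasFDerivAt (fun p => supportFn Ω 0 p - ⟪w, p⟫_ℝ)
      (innerSL ℝ (boundaryPt Ω y) - innerSL ℝ w) y :=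
    (h.hasFDerivAt hy).sub (innerSL ℝ w).hasFDerivAt
  have hmin : IsLocalMin (fun p => supportFn Ω 0 p - ⟪w, p⟫_ℝ) y := by
    refine Eventually.of_forall fun p => ?_
    have h1 := inner_le_supportFn_zero hw p
    simp only
    rw [real_inner_comm y w, hyw, real_inner_comm p w]
    linarith
  have h0 := hmin.hasFDerivAt_eq_zero hd
  have h2 := congrArg (fun L => L (boundaryPt Ω y - w)) h0
  simp only [sub_apply, innerSL_apply_apply, ← inner_sub_left,
    zero_apply, inner_self_eq_zero] at h2
  exact (sub_eq_zero.1 h2).symm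

lemma boundaryPt_mem_and_inner {y : Space n} (hy : y ≠ 0) :
    boundaryPt Ω y ∈ Ω ∧ ⟪y, boundaryPt Ω y⟫_ℝ = supportFn Ω 0 y := by
  obtain ⟨p, hp, h1⟩ := exists_inner_eq_supportFn Ω 0 y
  rw [sub_zero] at h1
  rw [← h.eq_boundaryPt hy hp h1]
  exact ⟨hp, h1⟩

lemma boundaryPt_mem {y : Space n} (hy : y ≠ 0) : boundaryPt Ω y ∈ Ω :=
  (h.boundaryPt_mem_and_inner hy).1

lemma inner_boundaryPt {y : Space n} (hy : y ≠ 0) :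
    ⟪y, boundaryPt Ω y⟫_ℝ = supportFn Ω 0 y :=
  (h.boundaryPt_mem_and_inner hy).2

lemma inner_boundaryPt_sub {y : Space n} (hy : y ≠ 0) (z : Space n) :
    ⟪y, boundaryPt Ω y - z⟫_ℝ = supportFn Ω z y := by
  rw [inner_sub_right, h.inner_boundaryPt hy, supportFn_eq_sub Ω z]

lemma boundaryPt_smul {y : Space n} (hy : y ≠ 0) {r : ℝ} (hr : 0 < r) :
    boundaryPt Ω (r • y) = boundaryPt Ω y := by
  refine (h.eq_boundaryPt (smul_ne_zero hr.ne' hy) (h.boundaryPt_mem hy) ?_).symm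
  rw [inner_smul_left, h.inner_boundaryPt hy, supportFn_smul _ _ _ hr.le]
  rfl

lemma boundaryDeriv_self {y : Space n} (hy : y ≠ 0) : boundaryDeriv Ω y y = 0 := by
  have hc : HasDerivAt (fun s : ℝ => y + s • y) y 0 := by
    simpa using ((hasDerivAt_id (0 : ℝ)).smul_const y).const_add y
  have h1 : HasDerivAt (fun s : ℝ => boundaryPt Ω (y + s • y)) (boundaryDeriv Ω y y) 0 := by
    refine HasFDerivAt.comp_hasDerivAt_of_eq 0 (h.hasFDerivAt_boundaryPt hy) hc (by simp)
  have h2 : (fun s : ℝ => boundaryPt Ω (y + s • y)) =ᶠ[𝓝 0] fun _ => boundaryPt Ω y := by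
    filter_upwards [lt_mem_nhds (show (-1 : ℝ) < 0 by norm_num)] with s hs
    rw [show y + s • y = (1 + s) • y by rw [add_smul, one_smul]]
    exact h.boundaryPt_smul hy (by linarith)
  exact h1.unique ((hasDerivAt_const _ _).congr_of_eventuallyEq h2)

/-- Differentiate Euler's identity ⟨p, X(p)⟩ = u(p) and cancel the term ⟨w, X(y)⟩, which is the
derivative of u. -/
lemma inner_boundaryDeriv {y : Space n} (hy : y ≠ 0) (w : Space n) :
    ⟪y, boundaryDeriv Ω y w⟫_ℝ = 0 := by
  have h1 : HasFDerivAt (fun p => ⟪p, boundaryPt Ω p⟫_ℝ) _ y :=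
    (hasFDerivAt_id y).inner ℝ (h.hasFDerivAt_boundaryPt hy)
  have h2 : (fun p => ⟪p, boundaryPt Ω p⟫_ℝ) =ᶠ[𝓝 y] supportFn Ω 0 := by
    filter_upwards [isOpen_compl_singleton.mem_nhds hy] with p hp
    exact h.inner_boundaryPt hp
  have h3 := h1.unique ((h.hasFDerivAt hy).congr_of_eventuallyEq h2)
  have h4 := congrArg (fun L => L w) h3
  simp [fderivInnerCLM_apply] at h4
  rw [real_inner_comm w] at h4
  linarith

end IsSmoothStrictlyConvex

end GaussFlow

/-! ### The operator A_u as a Euclidean Hessian, and its determinant -/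

namespace GaussFlow

open Filter Topology

lemma mem_tangent_iff {n : ℕ} {x v : Space n} : v ∈ tangent x ↔ ⟪x, v⟫_ℝ = 0 :=
  Submodule.mem_orthogonal_singleton_iff_inner_right

/-- A linear endomorphism that is positive definite has positive determinant. -/
lemma det_pos_of_forall_inner_pos {V : Type*} [NormedAddCommGroup V] [InnerProductSpace ℝ V]
    [FiniteDimensional ℝ V] (A : V →L[ℝ] V) (hA : ∀ v, v ≠ 0 → 0 < ⟪A v, v⟫_ℝ) : 0 < A.det := by
  -- Every operator on the segment from the identity to A is positive definite, hence invertible, so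
  -- the determinant keeps its sign. Symmetry of A plays no role.
  set B : ℝ → V →L[ℝ] V := fun s => s • A + (1 - s) • ContinuousLinearMap.id ℝ V with hB
  have hcont : Continuous fun s => (B s).det :=
    ContinuousLinearMap.continuous_det.comp (by fun_prop)
  have hne : ∀ s ∈ Icc (0 : ℝ) 1, (B s).det ≠ 0 := by
    intro s hs h0
    have h1 := LinearMap.bot_lt_ker_of_det_eq_zero (f := (B s : V →ₗ[ℝ] V)) h0
    obtain ⟨v, hv, hv0⟩ := Submodule.exists_mem_ne_zero_of_ne_bot h1.ne'
    have h2 : B s v = 0 := hv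
    have h3 : ⟪B s v, v⟫_ℝ = s * ⟪A v, v⟫_ℝ + (1 - s) * ‖v‖ ^ 2 := by
      simp [hB, inner_add_left, inner_smul_left]
    rw [h2, inner_zero_left] at h3
    have h4 := hA v hv0
    have h5 : 0 < ‖v‖ ^ 2 := by positivity
    rcases hs.1.eq_or_lt with h6 | h6
    · rw [← h6] at h3
      linarith
    · nlinarith [mul_pos h6 h4, mul_nonneg (sub_nonneg.2 hs.2) h5.le]
  by_contra hcon
  have h0 : (B 0).det = 1 := by simp [hB, ContinuousLinearMap.det]
  have h1 : (B 1).det ≤ 0 := by simpa [hB] using hcon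
  obtain ⟨s, hs, hs0⟩ := intermediate_value_Icc' zero_le_one hcont.continuousOn
    (show (0 : ℝ) ∈ Icc ((B 1).det) ((B 0).det) by rw [h0]; exact ⟨h1, zero_le_one⟩)
  exact hne s hs hs0

lemma hasFDerivAt_norm_inv {n : ℕ} {y : Space n} (hy : y ≠ 0) :
    HasFDerivAt (fun p : Space n => ‖p‖⁻¹) (-(‖y‖⁻¹ ^ 3) • innerSL ℝ y) y := by
  have hn : ‖y‖ ≠ 0 := norm_ne_zero_iff.2 hy
  have h1 := ((hasStrictFDerivAt_norm_sq y).hasFDerivAt.sqrt (by positivity))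
  simp only [Real.sqrt_sq (norm_nonneg _)] at h1
  have h2 := (hasDerivAt_inv hn).comp_hasFDerivAt y h1
  refine h2.congr_fderiv ?_
  ext w
  simp
  field_simp

lemma hasFDerivAt_norm {n : ℕ} {y : Space n} (hy : y ≠ 0) :
    HasFDerivAt (fun p : Space n => ‖p‖) (‖y‖⁻¹ • innerSL ℝ y) y := by
  have hn : ‖y‖ ≠ 0 := norm_ne_zero_iff.2 hy
  have h1 := ((hasStrictFDerivAt_norm_sq y).hasFDerivAt.sqrt (by positivity))
  simp only [Real.sqrt_sq (norm_nonneg _)] at h1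
  refine h1.congr_fderiv ?_
  ext w
  simp
  field_simp

/-- The curvature determinant `det A_u` at `x`. -/
noncomputable def curvDet {n : ℕ} (Ω : ConvexBody (Space n)) (x : Space n) : ℝ :=
  (opA (supportFn Ω 0) x).det

namespace IsSmoothStrictlyConvex

variable {n : ℕ} {Ω : ConvexBody (Space n)} (h : IsSmoothStrictlyConvex Ω)
include h

lemma sphereGrad_eq {y : Space n} (hy : y ≠ 0) :
    sphereGrad (supportFn Ω 0) y =
      ‖y‖⁻¹ • boundaryPt Ω y - (supportFn Ω 0 y * ‖y‖⁻¹ ^ 3) • y := by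
  have h1 : HasFDerivAt (fun p => ‖p‖⁻¹ * supportFn Ω 0 p) _ y :=
    (hasFDerivAt_norm_inv hy).mul (h.hasFDerivAt hy)
  have h2 : radialExt (supportFn Ω 0) = fun p => ‖p‖⁻¹ * supportFn Ω 0 p := by
    funext p
    exact supportFn_smul _ _ _ (by positivity)
  rw [sphereGrad, h2]
  refine HasGradientAt.gradient ?_
  rw [hasGradientAt_iff_hasFDerivAt]
  refine h1.congr_fderiv ?_
  ext w
  simp
  ring

/-- The extension constant along rays is u(y)/‖y‖. Differentiating its gradient produces the
Euclidean Hessian, a term -u v that the summand u · id of A cancels, and a multiple of x that the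
tangential projection kills. -/
lemma opA_apply {x : Space n} (hx : x ∈ unitSphere n) (v : tangent x) :
    (opA (supportFn Ω 0) x v : Space n) = boundaryDeriv Ω x v := by
  have hx0 := ne_zero_of_mem_unitSphere hx
  have hx1 := norm_of_mem_unitSphere hx
  have hv : ⟪x, (v : Space n)⟫_ℝ = 0 := mem_tangent_iff.1 v.2
  have h1 : HasFDerivAt (fun y => ‖y‖⁻¹ • boundaryPt Ω y - (supportFn Ω 0 y * ‖y‖⁻¹ ^ 3) • y) _ x :=
    ((hasFDerivAt_norm_inv hx0).smul (h.hasFDerivAt_boundaryPt hx0)).sub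
      (((h.hasFDerivAt hx0).mul ((hasFDerivAt_norm_inv hx0).pow 3)).smul (hasFDerivAt_id x))
  have h2 : sphereGrad (supportFn Ω 0) =ᶠ[𝓝 x]
      fun y => ‖y‖⁻¹ • boundaryPt Ω y - (supportFn Ω 0 y * ‖y‖⁻¹ ^ 3) • y := by
    filter_upwards [isOpen_compl_singleton.mem_nhds hx0] with y hy
    exact h.sphereGrad_eq hy
  have h3 : fderiv ℝ (sphereGrad (supportFn Ω 0)) x v =
      boundaryDeriv Ω x v - supportFn Ω 0 x • (v : Space n) - ⟪boundaryPt Ω x, v⟫_ℝ • x := by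
    rw [h2.fderiv_eq, h1.fderiv]
    simp [hx1, hv]
    abel
  have h4 : sphereHess (supportFn Ω 0) x v =
      (tangent x).orthogonalProjectionOnto (boundaryDeriv Ω x v)
        - supportFn Ω 0 x • v := by
    have h5 : (tangent x).orthogonalProjectionOnto x = 0 :=
      Submodule.orthogonalProjectionOnto_orthogonal_apply_eq_zero
        (Submodule.mem_span_singleton_self x)
    simp only [sphereHess, ContinuousLinearMap.comp_apply, Submodule.subtypeL_apply]
    rw [h3, map_sub, map_sub, map_smul, map_smul, h5, smul_zero, sub_zero,
      Submodule.orthogonalProjectionOnto_mem_subspace_eq_self]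
  have h6 : opA (supportFn Ω 0) x v =
      (tangent x).orthogonalProjectionOnto (boundaryDeriv Ω x v) := by
    simp [opA, h4]
  rw [h6]
  exact congrArg Subtype.val (Submodule.orthogonalProjectionOnto_mem_subspace_eq_self
    (⟨boundaryDeriv Ω x v, mem_tangent_iff.2 (h.inner_boundaryDeriv hx0 _)⟩ : tangent x))

lemma curvDet_pos {x : Space n} (hx : x ∈ unitSphere n) : 0 < curvDet Ω x :=
  det_pos_of_forall_inner_pos _ (h.pos x hx)

/-- The Euclidean Hessian kills x and maps into the hyperplane orthogonal to x. Adding x ⊗ x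
therefore gives A on that hyperplane and the identity on the line through x. In this form the
determinant is taken on a space that does not depend on x. -/
lemma curvDet_eq {x : Space n} (hx : x ∈ unitSphere n) :
    curvDet Ω x = (boundaryDeriv Ω x + (innerSL ℝ x).smulRight x).det := by
  have hx0 := ne_zero_of_mem_unitSphere hx
  have hx1 := norm_of_mem_unitSphere hx
  have hc : IsCompl (tangent x) (Submodule.span ℝ {x}) :=
    (Submodule.isCompl_orthogonal (Submodule.span ℝ {x})).symm
  set e := Submodule.prodEquivOfIsCompl _ _ hc with he
  set A : tangent x →ₗ[ℝ] tangent x := (opA (supportFn Ω 0) x : tangent x →ₗ[ℝ] tangent x) with hA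
  set L : Space n →ₗ[ℝ] Space n :=
    ((boundaryDeriv Ω x + (innerSL ℝ x).smulRight x : Space n →L[ℝ] Space n) :
      Space n →ₗ[ℝ] Space n) with hL
  have hL' : L =
      (e : tangent x × Submodule.span ℝ {x} →ₗ[ℝ] Space n) ∘ₗ (A.prodMap LinearMap.id) ∘ₗ (e.symm : Space n →ₗ[ℝ] tangent x × Submodule.span ℝ {x}) := by
    suffices hs : L ∘ₗ (e : tangent x × Submodule.span ℝ {x} →ₗ[ℝ] Space n) =
        (e : tangent x × Submodule.span ℝ {x} →ₗ[ℝ] Space n) ∘ₗ (A.prodMap LinearMap.id) by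
      rw [← LinearMap.comp_assoc, ← hs, LinearMap.comp_assoc]
      ext w
      simp
    ext w
    · have hw : ⟪x, (w : Space n)⟫_ℝ = 0 := mem_tangent_iff.1 w.2
      simp [hL, he, hA, hw, h.opA_apply hx]
    · obtain ⟨r, hr⟩ := Submodule.mem_span_singleton.1 w.2
      simp [hL, he, ← hr, h.boundaryDeriv_self hx0, hx1]
  have h1 : LinearMap.det L = LinearMap.det A := by
    rw [hL', LinearMap.det_conj, LinearMap.det_prodMap]
    simp
  exact h1.symm

lemma continuousOn_curvDet : ContinuousOn (curvDet Ω) (unitSphere n) := by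
  have h1 : ContinuousOn (fun x : Space n =>
      (boundaryDeriv Ω x + (innerSL ℝ x).smulRight x).det) (unitSphere n) := by
    refine ContinuousLinearMap.continuous_det.comp_continuousOn ?_
    refine (h.continuousOn_boundaryDeriv.mono fun _ hx => ne_zero_of_mem_unitSphere hx).add ?_
    exact Continuous.continuousOn (by fun_prop)
  exact h1.congr fun x hx => h.curvDet_eq hx

lemma boundaryDeriv_smul {y : Space n} (hy : y ≠ 0) {r : ℝ} (hr : 0 < r) :
    boundaryDeriv Ω (r • y) = r⁻¹ • boundaryDeriv Ω y := by
  have h0 : r⁻¹ • (r • y) = y := inv_smul_smul₀ hr.ne' y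
  have h1 : HasFDerivAt (fun p : Space n => r⁻¹ • p) (r⁻¹ • ContinuousLinearMap.id ℝ (Space n))
      (r • y) := (r⁻¹ • ContinuousLinearMap.id ℝ (Space n)).hasFDerivAt
  have h2 : HasFDerivAt (fun p : Space n => boundaryPt Ω (r⁻¹ • p)) _ (r • y) :=
    HasFDerivAt.comp (g := boundaryPt Ω) (r • y) (by rw [h0]; exact h.hasFDerivAt_boundaryPt hy) h1
  have h3 : (fun p : Space n => boundaryPt Ω (r⁻¹ • p)) =ᶠ[𝓝 (r • y)] boundaryPt Ω := by
    filter_upwards [isOpen_compl_singleton.mem_nhds (smul_ne_zero hr.ne' hy)] with p hp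
    exact h.boundaryPt_smul hp (inv_pos.2 hr)
  have h4 := (h.hasFDerivAt_boundaryPt (smul_ne_zero hr.ne' hy)).unique
    (h2.congr_of_eventuallyEq h3.symm)
  rw [h4]
  ext w
  simp

/-- The derivative of the map `y ↦ ‖y‖ • (boundaryPt Ω y - z)` in direction `θ`. -/
noncomputable def _root_.GaussFlow.coneDeriv {n : ℕ} (Ω : ConvexBody (Space n)) (z θ : Space n) :
    Space n →L[ℝ] Space n :=
  boundaryDeriv Ω θ + (innerSL ℝ θ).smulRight (boundaryPt Ω θ - z)

/-- The operator factors as D²u + θ ⊗ θ followed by the transvection along X(θ) - z - θ. The latter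
has determinant 1 + ⟨θ, X(θ) - z - θ⟩, which is the support function about z. -/
lemma det_coneDeriv (z : Space n) {θ : Space n} (hθ : θ ∈ unitSphere n) :
    (coneDeriv Ω z θ).det = supportFn Ω z θ * curvDet Ω θ := by
  have hx0 := ne_zero_of_mem_unitSphere hθ
  have hxx : ⟪θ, θ⟫_ℝ = 1 := by
    rw [real_inner_self_eq_norm_sq, norm_of_mem_unitSphere hθ, one_pow]
  rw [h.curvDet_eq hθ]
  have h1 : ((coneDeriv Ω z θ : Space n →L[ℝ] Space n) : Space n →ₗ[ℝ] Space n) =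
      LinearMap.transvection (innerₗ _ θ) (boundaryPt Ω θ - z - θ) ∘ₗ
      ((boundaryDeriv Ω θ + (innerSL ℝ θ).smulRight θ : Space n →L[ℝ] Space n) :
        Space n →ₗ[ℝ] Space n) := by
    ext1 w
    simp [coneDeriv, LinearMap.transvection.apply, inner_add_right, h.inner_boundaryDeriv hx0,
      inner_smul_right, smul_sub, norm_of_mem_unitSphere hθ]
  rw [ContinuousLinearMap.det, h1, LinearMap.det_comp, LinearMap.transvection.det]
  congr 1
  simp [inner_sub_right, h.inner_boundaryPt hx0, supportFn_eq_sub Ω z, norm_of_mem_unitSphere hθ]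

lemma hasFDerivAt_cone (z : Space n) {y : Space n} (hy : y ≠ 0) :
    HasFDerivAt (fun p => ‖p‖ • (boundaryPt Ω p - z)) (coneDeriv Ω z (‖y‖⁻¹ • y)) y := by
  have hn : 0 < ‖y‖ := norm_pos_iff.2 hy
  refine ((hasFDerivAt_norm hy).smul ((h.hasFDerivAt_boundaryPt hy).sub_const z)).congr_fderiv ?_
  ext1 w
  simp [coneDeriv, h.boundaryDeriv_smul hy (inv_pos.2 hn), h.boundaryPt_smul hy (inv_pos.2 hn)]

end IsSmoothStrictlyConvex

end GaussFlow

/-! ### Injectivity of the boundary parametrization, interior points and radial decomposition -/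

namespace GaussFlow

open Filter Topology

lemma exists_unit_orthogonal {n : ℕ} (hn : 1 ≤ n) (a : Space n) :
    ∃ v ∈ unitSphere n, ⟪a, v⟫_ℝ = 0 := by
  have h1 : Module.finrank ℝ (Submodule.span ℝ {a}) ≤ 1 := by
    simpa using finrank_span_le_card (R := ℝ) ({a} : Set (Space n))
  have h2 := (Submodule.span ℝ {a}).finrank_add_finrank_orthogonal
  rw [finrank_euclideanSpace_fin] at h2
  have h3 : (Submodule.span ℝ {a})ᗮ ≠ ⊥ := by
    intro h0
    have : Module.finrank ℝ (Submodule.span ℝ {a})ᗮ = 0 := by rw [h0]; exact finrank_bot ℝ _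
    omega
  obtain ⟨v, hv, hv0⟩ := Submodule.exists_mem_ne_zero_of_ne_bot h3
  refine ⟨‖v‖⁻¹ • v, normalize_mem_unitSphere hv0, ?_⟩
  rw [inner_smul_right, mem_tangent_iff.1 hv, mul_zero]

namespace IsSmoothStrictlyConvex

variable {n : ℕ} {Ω : ConvexBody (Space n)} (h : IsSmoothStrictlyConvex Ω)
include h

/-- A point with normals x and x' is the support point for every direction on the segment between
them, so the derivative of X at x kills x' - x and hence the tangential part of x'. Positive
definiteness makes that part zero, leaving x' = ±x. Antipodal pairs are excluded because their
segment meets 0, where u is not smooth. -/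
lemma eq_of_boundaryPt_eq {x x' : Space n} (hx : x ∈ unitSphere n) (hx' : x' ∈ unitSphere n)
    (hne : x' ≠ -x) (heq : boundaryPt Ω x = boundaryPt Ω x') : x' = x := by
  have hx0 := ne_zero_of_mem_unitSphere hx
  have hx0' := ne_zero_of_mem_unitSphere hx'
  have hx1 := norm_of_mem_unitSphere hx
  have hx1' := norm_of_mem_unitSphere hx'
  have hseg : ∀ s ∈ Icc (0 : ℝ) 1, x + s • (x' - x) ≠ 0 := by
    intro s hs h0
    have h1 : (1 - s) • x = -(s • x') := by
      rw [eq_neg_iff_add_eq_zero, ← h0]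
      module
    have h2 := congrArg norm h1
    rw [norm_neg, norm_smul, norm_smul, hx1, hx1', Real.norm_of_nonneg hs.1,
      Real.norm_of_nonneg (sub_nonneg.2 hs.2)] at h2
    have h3 : s = 1 / 2 := by linarith
    apply hne
    rw [eq_neg_iff_add_eq_zero]
    have h4 : (2 : ℝ) • (x + s • (x' - x)) = x' + x := by
      rw [h3]
      module
    rw [← h4, h0, smul_zero]
  have hconst : ∀ s ∈ Icc (0 : ℝ) 1, boundaryPt Ω (x + s • (x' - x)) = boundaryPt Ω x := by
    intro s hs
    refine (h.eq_boundaryPt (hseg s hs) (h.boundaryPt_mem hx0) (le_antisymm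
      (inner_le_supportFn_zero (h.boundaryPt_mem hx0) _) ?_)).symm
    rw [← h.inner_boundaryPt (hseg s hs)]
    set q := boundaryPt Ω (x + s • (x' - x))
    have hq : q ∈ Ω := h.boundaryPt_mem (hseg s hs)
    have h1 := inner_le_supportFn_zero hq x
    have h2 := inner_le_supportFn_zero hq x'
    rw [← h.inner_boundaryPt hx0] at h1
    rw [← h.inner_boundaryPt hx0', ← heq] at h2
    have h3 : ∀ p : Space n, ⟪x + s • (x' - x), p⟫_ℝ = (1 - s) * ⟪x, p⟫_ℝ + s * ⟪x', p⟫_ℝ := by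
      intro p
      rw [inner_add_left, inner_smul_left, inner_sub_left]
      simp only [conj_trivial]
      ring
    rw [h3, h3]
    have := mul_le_mul_of_nonneg_left h1 (sub_nonneg.2 hs.2)
    have := mul_le_mul_of_nonneg_left h2 hs.1
    linarith
  have hc : HasDerivAt (fun s : ℝ => x + s • (x' - x)) (x' - x) 0 := by
    simpa using ((hasDerivAt_id (0 : ℝ)).smul_const (x' - x)).const_add x
  have h1 : HasDerivAt (fun s : ℝ => boundaryPt Ω (x + s • (x' - x)))
      (boundaryDeriv Ω x (x' - x)) 0 :=
    HasFDerivAt.comp_hasDerivAt_of_eq 0 (h.hasFDerivAt_boundaryPt hx0) hc (by simp)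
  have h2 : boundaryDeriv Ω x (x' - x) = 0 := by
    have h3 : HasDerivWithinAt (fun s : ℝ => boundaryPt Ω (x + s • (x' - x))) 0 (Icc 0 1) 0 :=
      (hasDerivWithinAt_const _ _ (boundaryPt Ω x)).congr hconst
        (hconst 0 ⟨le_rfl, zero_le_one⟩)
    exact (uniqueDiffOn_Icc zero_lt_one 0 ⟨le_rfl, zero_le_one⟩).eq_deriv _
      h1.hasDerivWithinAt h3
  set c := ⟪x, x'⟫_ℝ
  have hv : x' - c • x ∈ tangent x := by
    rw [mem_tangent_iff, inner_sub_right, inner_smul_right, real_inner_self_eq_norm_sq, hx1]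
    simp [c]
  have h4 : boundaryDeriv Ω x (x' - c • x) = 0 := by
    rw [show x' - c • x = (x' - x) + (1 - c) • x by module, map_add, h2, map_smul,
      h.boundaryDeriv_self hx0, smul_zero, add_zero]
  have h5 : (⟨x' - c • x, hv⟩ : tangent x) = 0 := by
    by_contra h0
    have h6 := h.pos x hx _ h0
    rw [Submodule.coe_inner, h.opA_apply hx, h4, inner_zero_left] at h6
    exact lt_irrefl _ h6
  have h6 : x' = c • x := sub_eq_zero.1 (congrArg Subtype.val h5)
  have h7 : |c| = 1 := by
    have := congrArg norm h6
    rw [norm_smul, hx1, hx1', mul_one] at this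
    exact this.symm
  rcases eq_or_eq_neg_of_abs_eq h7 with h8 | h8
  · rw [h6, h8, one_smul]
  · exact absurd (by rw [h6, h8, neg_smul, one_smul]) hne

/-- If Ω lay in a hyperplane with normal a, then for a unit vector v orthogonal to a, which exists
since n ≥ 1, the directions v and a + v would have the same support point, against the injectivity
up to antipodes. -/
lemma interior_nonempty (hn : 1 ≤ n) : (interior (Ω : Set (Space n))).Nonempty := by
  rw [Ω.convex.interior_nonempty_iff_affineSpan_eq_top]
  by_contra hspan
  obtain ⟨p₀, hp₀⟩ := Ω.nonempty
  have hdir : vectorSpan ℝ (Ω : Set (Space n)) ≠ ⊤ := by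
    intro h0
    apply hspan
    rw [AffineSubspace.affineSpan_eq_top_iff_vectorSpan_eq_top_of_nonempty _ _ _ ⟨p₀, hp₀⟩]
    exact h0
  have horth : (vectorSpan ℝ (Ω : Set (Space n)))ᗮ ≠ ⊥ := by
    rwa [Ne, Submodule.orthogonal_eq_bot_iff]
  obtain ⟨a, ha, ha0⟩ := Submodule.exists_mem_ne_zero_of_ne_bot horth
  have hconst : ∀ p ∈ Ω, ⟪a, p⟫_ℝ = ⟪a, p₀⟫_ℝ := by
    intro p hp
    have h1 := (Submodule.mem_orthogonal' _ _).1 ha (p - p₀) (vsub_mem_vectorSpan ℝ hp hp₀)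
    rw [inner_sub_right] at h1
    linarith
  obtain ⟨v, hv, hav⟩ := exists_unit_orthogonal hn a
  have hv0 := ne_zero_of_mem_unitSphere hv
  have hpos : 0 < ⟪a, a⟫_ℝ := real_inner_self_pos.2 ha0
  have hw0 : a + v ≠ 0 := by
    intro h0
    have h1 := congrArg (fun w => ⟪a, w⟫_ℝ) h0
    simp only [inner_add_right, hav, inner_zero_right] at h1
    linarith
  have h1 : boundaryPt Ω v = boundaryPt Ω (a + v) := by
    refine h.eq_boundaryPt hw0 (h.boundaryPt_mem hv0) (le_antisymm
      (inner_le_supportFn_zero (h.boundaryPt_mem hv0) _) ?_)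
    rw [← h.inner_boundaryPt hw0, inner_add_left, inner_add_left, h.inner_boundaryPt hv0,
      hconst _ (h.boundaryPt_mem hv0), hconst _ (h.boundaryPt_mem hw0)]
    have := inner_le_supportFn_zero (h.boundaryPt_mem hw0) v
    linarith
  have hnorm : 0 < ‖a + v‖⁻¹ := inv_pos.2 (norm_pos_iff.2 hw0)
  rw [← h.boundaryPt_smul hw0 hnorm] at h1
  have hθ : ⟪a, ‖a + v‖⁻¹ • (a + v)⟫_ℝ ≠ 0 := by
    rw [inner_smul_right, inner_add_right, hav, add_zero]
    positivity
  apply hθ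
  by_cases hcase : ‖a + v‖⁻¹ • (a + v) = -v
  · rw [hcase, inner_neg_right, hav, neg_zero]
  · rw [h.eq_of_boundaryPt_eq hv (normalize_mem_unitSphere hw0) hcase h1, hav]

lemma exists_supportFn_pos (hn : 1 ≤ n) :
    ∃ z ∈ Ω, ∀ x ∈ unitSphere n, 0 < supportFn Ω z x := by
  obtain ⟨z, hz⟩ := h.interior_nonempty hn
  exact ⟨z, interior_subset hz, fun x hx => supportFn_pos_of_mem_interior hz hx⟩

lemma continuousOn_supportFn (z : Space n) : ContinuousOn (supportFn Ω z) {0}ᶜ := by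
  rw [show supportFn Ω z = fun x => supportFn Ω 0 x - ⟪x, z⟫_ℝ from
    funext fun x => supportFn_eq_sub Ω z x]
  exact h.smooth.continuousOn.sub (by fun_prop)

variable {z : Space n} (hz : ∀ x ∈ unitSphere n, 0 < supportFn Ω z x)
include hz

lemma injOn_boundaryPt : InjOn (boundaryPt Ω) (unitSphere n) := by
  intro x hx x' hx' heq
  by_contra hne
  by_cases hcase : x' = -x
  · have h1 := hz x hx
    have h2 := hz x' hx'
    rw [← h.inner_boundaryPt_sub (ne_zero_of_mem_unitSphere hx)] at h1
    rw [← h.inner_boundaryPt_sub (ne_zero_of_mem_unitSphere hx'), ← heq, hcase,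
      inner_neg_left] at h2
    linarith
  · exact hne (h.eq_of_boundaryPt_eq hx hx' hcase heq).symm

/-- The maximum r of ⟨x, q⟩ / u_z(x) over the sphere is the gauge of Ω - z at q: the point z + q/r
lies in Ω and touches the supporting hyperplane whose normal is the maximizer. -/
lemma exists_smul_boundaryPt_sub {q : Space n} (hq : q ≠ 0) :
    ∃ θ ∈ unitSphere n, ∃ r : ℝ, 0 < r ∧ q = r • (boundaryPt Ω θ - z) := by
  have hne : (unitSphere n).Nonempty := NormedSpace.sphere_nonempty.2 zero_le_one
  have hc : ContinuousOn (fun x => ⟪x, q⟫_ℝ / supportFn Ω z x) (unitSphere n) :=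
    ContinuousOn.div (by fun_prop)
      ((h.continuousOn_supportFn z).mono fun x hx => ne_zero_of_mem_unitSphere hx)
      fun x hx => (hz x hx).ne'
  obtain ⟨θ, hθ, hmax⟩ := (isCompact_sphere (0 : Space n) 1).exists_isMaxOn hne hc
  have hθ0 := ne_zero_of_mem_unitSphere hθ
  set r := ⟪θ, q⟫_ℝ / supportFn Ω z θ with hr
  have hr0 : 0 < r := by
    have h1 := normalize_mem_unitSphere hq
    refine lt_of_lt_of_le ?_ (hmax h1)
    refine div_pos ?_ (hz _ h1)
    rw [inner_smul_left]
    exact mul_pos (inv_pos.2 (norm_pos_iff.2 hq)) (real_inner_self_pos.2 hq)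
  have hmem : z + r⁻¹ • q ∈ Ω := by
    refine mem_of_forall_inner_le fun x hx => ?_
    have h1 : ⟪x, q⟫_ℝ / supportFn Ω z x ≤ r := hmax hx
    rw [div_le_iff₀ (hz x hx)] at h1
    have h2 : r⁻¹ * ⟪x, q⟫_ℝ ≤ supportFn Ω z x := by
      rw [inv_mul_le_iff₀ hr0]
      exact h1
    rw [supportFn_eq_sub Ω z] at h2
    rw [inner_add_right, inner_smul_right]
    linarith
  have heq : z + r⁻¹ • q = boundaryPt Ω θ := by
    refine h.eq_boundaryPt hθ0 hmem ?_
    have h1 : ⟪θ, q⟫_ℝ = r * supportFn Ω z θ := by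
      rw [hr, div_mul_cancel₀ _ (hz θ hθ).ne']
    rw [inner_add_right, inner_smul_right, h1, inv_mul_cancel_left₀ hr0.ne', supportFn_eq_sub Ω z]
    ring
  refine ⟨θ, hθ, r, hr0, ?_⟩
  rw [← heq, add_sub_cancel_left, smul_inv_smul₀ hr0.ne']

/-- Write y - z = r (X(θ) - z). Membership in Ω forces r ≤ 1, and r < 1 makes the support function
about y positive, so that y is interior. -/
lemma frontier_eq : frontier (Ω : Set (Space n)) = boundaryPt Ω '' unitSphere n := by
  rw [Ω.isClosed.frontier_eq]
  ext y
  constructor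
  · rintro ⟨hy, hyi⟩
    have hyz : y - z ≠ 0 := by
      intro h0
      rw [sub_eq_zero] at h0
      exact hyi (h0 ▸ mem_interior_of_supportFn_pos h.continuousOn_sphere hz)
    obtain ⟨θ, hθ, r, hr, heq⟩ := h.exists_smul_boundaryPt_sub hz hyz
    have hθ0 := ne_zero_of_mem_unitSphere hθ
    have hr1 : r ≤ 1 := by
      have h1 := inner_le_supportFn hy z θ
      rw [heq, inner_smul_right, h.inner_boundaryPt_sub hθ0] at h1
      have := hz θ hθ
      by_contra hcon
      nlinarith [not_le.1 hcon]
    rcases hr1.eq_or_lt with h1 | h1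
    · rw [h1, one_smul, sub_left_inj] at heq
      exact ⟨θ, hθ, heq.symm⟩
    · refine absurd (mem_interior_of_supportFn_pos h.continuousOn_sphere fun x hx => ?_) hyi
      have hX := inner_le_supportFn (h.boundaryPt_mem hθ0) z x
      have h2 := congrArg (fun w => ⟪x, w⟫_ℝ) heq
      simp only [inner_smul_right] at h2
      have h3 := hz x hx
      have h4 : ⟪x, y - z⟫_ℝ < supportFn Ω z x := by
        rw [h2]
        nlinarith [mul_le_mul_of_nonneg_left hX hr.le]
      rw [supportFn_eq_sub] at h4 ⊢
      rw [inner_sub_right] at h4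
      linarith
  · rintro ⟨θ, hθ, rfl⟩
    have hθ0 := ne_zero_of_mem_unitSphere hθ
    refine ⟨h.boundaryPt_mem hθ0, fun hi => ?_⟩
    have h1 := supportFn_pos_of_mem_interior hi hθ
    rw [supportFn_eq_sub, h.inner_boundaryPt hθ0] at h1
    linarith

/-- Pairing an equality of values with p gives ‖p‖ u_z(p) ≤ ‖p'‖ u_z(p), hence ‖p‖ ≤ ‖p'‖, and by
symmetry the norms agree. Injectivity of X on the sphere then identifies the directions. -/
lemma injOn_cone : InjOn (fun p => ‖p‖ • (boundaryPt Ω p - z)) {0}ᶜ := by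
  have key : ∀ p p' : Space n, p ≠ 0 → p' ≠ 0 →
      ‖p‖ • (boundaryPt Ω p - z) = ‖p'‖ • (boundaryPt Ω p' - z) → ‖p‖ ≤ ‖p'‖ := by
    intro p p' hp hp' heq
    have hv : 0 < supportFn Ω z p := by
      have h1 := hz _ (normalize_mem_unitSphere hp)
      rw [supportFn_smul _ _ _ (by positivity)] at h1
      exact pos_of_mul_pos_right h1 (by positivity)
    have h1 := congrArg (fun w => ⟪p, w⟫_ℝ) heq
    simp only [inner_smul_right, h.inner_boundaryPt_sub hp] at h1
    have h2 := mul_le_mul_of_nonneg_left (inner_le_supportFn (h.boundaryPt_mem hp') z p)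
      (norm_nonneg p')
    rw [← h1] at h2
    exact le_of_mul_le_mul_right h2 hv
  intro p hp p' hp' heq
  have hnorm : ‖p‖ = ‖p'‖ := le_antisymm (key p p' hp hp' heq) (key p' p hp' hp heq.symm)
  have hpn : 0 < ‖p‖ := norm_pos_iff.2 hp
  have hpn' : 0 < ‖p'‖ := norm_pos_iff.2 hp'
  simp only [hnorm] at heq
  have h1 := sub_left_inj.1 (smul_right_injective _ hpn'.ne' heq)
  rw [← h.boundaryPt_smul hp (inv_pos.2 hpn), ← h.boundaryPt_smul hp' (inv_pos.2 hpn')] at h1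
  have h2 := h.injOn_boundaryPt hz (normalize_mem_unitSphere hp) (normalize_mem_unitSphere hp') h1
  rw [hnorm] at h2
  exact smul_right_injective _ (inv_pos.2 hpn').ne' h2

end IsSmoothStrictlyConvex

end GaussFlow

namespace GaussFlow

open Filter Topology

/-! ### Polar coordinates and the volume -/

lemma integrable_sphere_of_continuous {n : ℕ} {f : unitSphere n → ℝ} (hf : Continuous f) :
    Integrable f (sphereMeasure n) :=
  hf.integrable_of_hasCompactSupport (HasCompactSupport.of_compactSpace f)

lemma measurableSet_radial {n : ℕ} {k : Space n → ℝ}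
    (hk : Measurable fun θ : unitSphere n => k θ) :
    MeasurableSet {y : Space n | y ≠ 0 ∧ ‖y‖ < k (‖y‖⁻¹ • y)} := by
  have h1 : MeasurableSet {p : ({0}ᶜ : Set (Space n)) |
      ‖(p : Space n)‖ < k ((homeomorphUnitSphereProd (Space n)) p).1} :=
    measurableSet_lt (by fun_prop)
      (hk.comp (measurable_fst.comp (homeomorphUnitSphereProd (Space n)).measurable))
  have h2 := (MeasurableEmbedding.subtype_coe
    (measurableSet_singleton (0 : Space n)).compl).measurableSet_image.2 h1
  convert h2 using 1
  ext y
  simp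
  tauto

/-- Polar coordinates: the radial measure r^n dr gives the interval (0, k) the mass k^{n+1}/(n+1).
-/
lemma setLIntegral_radial {n : ℕ} {k : Space n → ℝ} {G : Space n → ENNReal}
    (hk : Measurable fun θ : unitSphere n => k θ) (hG : Measurable fun θ : unitSphere n => G θ)
    (hk0 : ∀ θ ∈ unitSphere n, 0 < k θ) :
    ∫⁻ y in {y : Space n | y ≠ 0 ∧ ‖y‖ < k (‖y‖⁻¹ • y)}, G (‖y‖⁻¹ • y) =
      ∫⁻ θ : unitSphere n, G θ * ENNReal.ofReal (k θ ^ (n + 1) / (n + 1)) ∂(sphereMeasure n) := by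
  set R := {y : Space n | y ≠ 0 ∧ ‖y‖ < k (‖y‖⁻¹ • y)} with hR
  have hm : MeasurableSet R := measurableSet_radial hk
  have hc : MeasurableSet ({0}ᶜ : Set (Space n)) := (measurableSet_singleton _).compl
  set F : unitSphere n × Ioi (0 : ℝ) → ENNReal :=
    {p : unitSphere n × Ioi (0 : ℝ) | (p.2 : ℝ) < k p.1}.indicator fun p => G p.1 with hF
  have hFm : Measurable F := by
    refine Measurable.indicator (hG.comp measurable_fst) ?_
    exact measurableSet_lt (measurable_subtype_coe.comp measurable_snd) (hk.comp measurable_fst)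
  have h1 : ∫⁻ y in R, G (‖y‖⁻¹ • y) =
      ∫⁻ p : ({0}ᶜ : Set (Space n)), F (homeomorphUnitSphereProd (Space n) p)
        ∂(Measure.comap Subtype.val volume) := by
    rw [← lintegral_indicator hm, ← setLIntegral_eq_of_support_subset (s := {0}ᶜ), ←
      lintegral_subtype_comap hc]
    · refine lintegral_congr fun p => ?_
      have hp : (p : Space n) ≠ 0 := p.2
      by_cases hpk : ‖(p : Space n)‖ < k (‖(p : Space n)‖⁻¹ • (p : Space n))
      · rw [indicator_of_mem (show (p : Space n) ∈ R from ⟨hp, hpk⟩), hF, indicator_of_mem]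
        · simp
        · simpa using hpk
      · rw [indicator_of_notMem (fun hh => hpk hh.2), hF, indicator_of_notMem]
        simpa using hpk
    · intro y hy
      by_contra h0
      apply hy
      rw [indicator_of_notMem]
      exact fun hh => h0 hh.1
  rw [h1, (volume : Measure (Space n)).measurePreserving_homeomorphUnitSphereProd.lintegral_comp_emb
    (Homeomorph.measurableEmbedding _), lintegral_prod _ hFm.aemeasurable]
  refine lintegral_congr fun θ => ?_
  have h2 : (fun r => F (θ, r)) = (Iio (⟨k θ, hk0 θ θ.2⟩ : Ioi (0 : ℝ))).indicator fun _ => G θ := by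
    funext r
    simp only [hF, indicator]
    rfl
  rw [h2, lintegral_indicator measurableSet_Iio, setLIntegral_const, finrank_euclideanSpace_fin,
    Nat.add_sub_cancel, Measure.volumeIoiPow_apply_Iio]

namespace IsSmoothStrictlyConvex

variable {n : ℕ} {Ω : ConvexBody (Space n)} (h : IsSmoothStrictlyConvex Ω)
include h

lemma continuous_curvDet_sphere : Continuous fun θ : unitSphere n => curvDet Ω θ :=
  continuousOn_iff_continuous_domRestrict.1 h.continuousOn_curvDet

lemma continuous_supportFn_sphere (z : Space n) :
    Continuous fun θ : unitSphere n => supportFn Ω z θ :=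
  continuousOn_iff_continuous_domRestrict.1
    ((h.continuousOn_supportFn z).mono fun _ hx => ne_zero_of_mem_unitSphere hx)

variable {z : Space n} (hz : ∀ x ∈ unitSphere n, 0 < supportFn Ω z x)
include hz

lemma volume_cone_image {k : Space n → ℝ} (hk : Measurable fun θ : unitSphere n => k θ)
    (hk0 : ∀ θ ∈ unitSphere n, 0 < k θ) :
    volume ((fun p => ‖p‖ • (boundaryPt Ω p - z)) ''
      {y : Space n | y ≠ 0 ∧ ‖y‖ < k (‖y‖⁻¹ • y)}) =
    ∫⁻ θ : unitSphere n, ENNReal.ofReal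
      (k θ ^ (n + 1) / (n + 1) * (supportFn Ω z θ * curvDet Ω θ)) ∂(sphereMeasure n) := by
  rw [← lintegral_abs_det_fderiv_eq_addHaar_image volume (measurableSet_radial hk)
    (fun y hy => (h.hasFDerivAt_cone z hy.1).hasFDerivWithinAt)
    ((h.injOn_cone hz).mono fun y hy => hy.1)]
  have h1 : ∀ θ ∈ unitSphere n, |(coneDeriv Ω z θ).det| = supportFn Ω z θ * curvDet Ω θ := by
    intro θ hθ
    rw [h.det_coneDeriv z hθ]
    exact abs_of_pos (mul_pos (hz θ hθ) (h.curvDet_pos hθ))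
  have h2 := setLIntegral_radial (G := fun y => ENNReal.ofReal |(coneDeriv Ω z y).det|) hk
    (by
      simp_rw [fun θ : unitSphere n => h1 θ θ.2]
      exact ((h.continuous_supportFn_sphere z).mul h.continuous_curvDet_sphere).measurable.ennreal_ofReal)
    hk0
  rw [h2]
  refine lintegral_congr fun θ => ?_
  have hk1 := hk0 θ θ.2
  rw [h1 θ θ.2, mul_comm, ← ENNReal.ofReal_mul (by positivity)]

/-- An interior point q ≠ z' of Ω' satisfies q - z' = r (X(θ) - z). Pairing with θ gives r u_z(θ) <
u'_{z'}(θ) ≤ k(θ) u_z(θ), so r < k(θ), and a translate of the cone image covers the interior up to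
one point. -/
lemma volume_le_of_supportFn_le {Ω' : ConvexBody (Space n)} {k : Space n → ℝ}
    (hk : Measurable fun θ : unitSphere n => k θ) (hk0 : ∀ θ ∈ unitSphere n, 0 < k θ)
    {z' : Space n}
    (hle : ∀ θ ∈ unitSphere n, supportFn Ω' z' θ ≤ k θ * supportFn Ω z θ) :
    volume (Ω' : Set (Space n)) ≤ ∫⁻ θ : unitSphere n, ENNReal.ofReal
      (k θ ^ (n + 1) / (n + 1) * (supportFn Ω z θ * curvDet Ω θ)) ∂(sphereMeasure n) := by
  rw [← h.volume_cone_image hz hk hk0,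
    ← measure_interior_of_null_frontier (Ω'.convex.addHaar_frontier volume)]
  set Φ := fun p => ‖p‖ • (boundaryPt Ω p - z)
  have hsub : interior (Ω' : Set (Space n)) ⊆
      {z'} ∪ (fun p => p + z') '' (Φ '' {y : Space n | y ≠ 0 ∧ ‖y‖ < k (‖y‖⁻¹ • y)}) := by
    intro q hq
    by_cases hqz : q = z'
    · exact Or.inl hqz
    refine Or.inr ⟨q - z', ?_, sub_add_cancel q z'⟩
    obtain ⟨θ, hθ, r, hr, heq⟩ := h.exists_smul_boundaryPt_sub hz (sub_ne_zero.2 hqz)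
    have hθ0 := ne_zero_of_mem_unitSphere hθ
    have hθ1 := norm_of_mem_unitSphere hθ
    have hnorm : ‖r • θ‖ = r := by rw [norm_smul, hθ1, mul_one, Real.norm_of_nonneg hr.le]
    refine ⟨r • θ, ⟨smul_ne_zero hr.ne' hθ0, ?_⟩, ?_⟩
    · rw [hnorm, inv_smul_smul₀ hr.ne']
      have h1 := congrArg (fun w => ⟪θ, w⟫_ℝ) heq
      simp only [inner_smul_right, h.inner_boundaryPt_sub hθ0] at h1
      have h2 := supportFn_pos_of_mem_interior hq hθ
      rw [supportFn_eq_sub] at h2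
      have h3 := hle θ hθ
      rw [supportFn_eq_sub Ω' z'] at h3
      rw [inner_sub_right] at h1
      exact lt_of_mul_lt_mul_right (by linarith) (hz θ hθ).le
    · simp only [Φ]
      rw [hnorm, h.boundaryPt_smul hθ0 hr, heq]
  calc volume (interior (Ω' : Set (Space n))) ≤ _ := measure_mono hsub
    _ ≤ volume {z'} + volume ((fun p => p + z') '' (Φ '' _)) := measure_union_le _ _
    _ = _ := by rw [measure_singleton, zero_add, image_add_right, measure_preimage_add_right]

/-- With k = 1 the previous comparison gives one inequality; for the other, the cone image consists
of points on segments from z to the boundary, which stay in Ω by convexity. -/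
lemma volume_eq : volume (Ω : Set (Space n)) = ∫⁻ θ : unitSphere n, ENNReal.ofReal
    (1 / (n + 1) * (supportFn Ω z θ * curvDet Ω θ)) ∂(sphereMeasure n) := by
  refine le_antisymm ?_ ?_
  · have := h.volume_le_of_supportFn_le hz (k := fun _ => 1) measurable_const
      (fun _ _ => zero_lt_one) (Ω' := Ω) (z' := z) (fun θ _ => by rw [one_mul])
    simpa using this
  · have h1 := h.volume_cone_image hz (k := fun _ => 1) measurable_const (fun _ _ => zero_lt_one)
    simp only [one_pow] at h1
    rw [← h1]
    set Φ := fun p => ‖p‖ • (boundaryPt Ω p - z)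
    have hsub : (fun p => p + z) '' (Φ '' {y : Space n | y ≠ 0 ∧ ‖y‖ < 1}) ⊆
        (Ω : Set (Space n)) := by
      rintro _ ⟨_, ⟨y, hy, rfl⟩, rfl⟩
      have h2 : Φ y + z = ‖y‖ • boundaryPt Ω y + (1 - ‖y‖) • z := by
        simp only [Φ]
        module
      simp only [h2]
      exact Ω.convex (h.boundaryPt_mem hy.1) (mem_of_supportFn_nonneg fun x hx => (hz x hx).le)
        (norm_nonneg y) (by linarith [hy.2]) (by ring)
    refine le_trans (le_of_eq ?_) (measure_mono hsub)
    rw [image_add_right, measure_preimage_add_right]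

end IsSmoothStrictlyConvex

end GaussFlow

namespace GaussFlow

open Filter Topology
open scoped NNReal ENNReal

/-! ### The area formula for the boundary of a smooth convex body -/

section MeasureComparison

/-- A local comparison of two measures on a compact space is global. -/
lemma measure_le_of_forall_nhds {X : Type*} [TopologicalSpace X] [CompactSpace X]
    [MeasurableSpace X] [BorelSpace X] {μ ν : Measure X} {c : ℝ≥0∞}
    (hloc : ∀ x : X, ∃ U ∈ 𝓝 x, ∀ E ⊆ U, MeasurableSet E → μ E ≤ c * ν E)
    {E : Set X} (hE : MeasurableSet E) : μ E ≤ c * ν E := by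
  have key : ∃ t, (univ : Set X) ⊆ t ∧ MeasurableSet t ∧
      ∀ E ⊆ t, MeasurableSet E → μ E ≤ c * ν E := by
    refine isCompact_univ.induction_on
      (p := fun s => ∃ t, s ⊆ t ∧ MeasurableSet t ∧ ∀ E ⊆ t, MeasurableSet E → μ E ≤ c * ν E)
      ?_ ?_ ?_ ?_
    · refine ⟨∅, subset_rfl, .empty, fun E hE _ => ?_⟩
      simp [subset_empty_iff.1 hE]
    · rintro s s' hss ⟨t, ht, hm, h⟩
      exact ⟨t, hss.trans ht, hm, h⟩
    · rintro s s' ⟨t, hst, hm, h⟩ ⟨t', hst', hm', h'⟩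
      refine ⟨t ∪ t', union_subset_union hst hst', hm.union hm', fun E hE hEm => ?_⟩
      rw [← measure_inter_add_sdiff E hm, ← measure_inter_add_sdiff (μ := ν) E hm, mul_add]
      refine add_le_add (h _ inter_subset_right (hEm.inter hm)) (h' _ ?_ (hEm.diff hm))
      exact fun x hx => (hE hx.1).resolve_left hx.2
    · intro x _
      obtain ⟨U, hU, h⟩ := hloc x
      exact ⟨interior U, mem_nhdsWithin_of_mem_nhds (interior_mem_nhds.2 hU), interior U,
        subset_rfl, isOpen_interior.measurableSet,
        fun E hE hEm => h E (hE.trans interior_subset) hEm⟩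
  obtain ⟨t, ht, -, h⟩ := key
  exact h E ((subset_univ _).trans ht) hE

lemma le_of_forall_one_lt_le_mul {a b : ℝ≥0∞} (h : ∀ c : ℝ≥0, 1 < c → a ≤ c * b) : a ≤ b := by
  rcases eq_or_ne b ⊤ with rfl | hb
  · exact le_top
  have h1 : Tendsto (fun c : ℝ≥0 => (c : ℝ≥0∞) * b) (𝓝[>] 1) (𝓝 ((1 : ℝ≥0) * b)) :=
    (ENNReal.Tendsto.mul_const ((ENNReal.continuous_coe.tendsto 1)) (Or.inr hb)).mono_left
      nhdsWithin_le_nhds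
  rw [ENNReal.coe_one, one_mul] at h1
  exact ge_of_tendsto h1 (by filter_upwards [self_mem_nhdsWithin] with c hc using h c hc)

lemma euclideanHausdorffMeasure_le_of_edist_le {X Y : Type*} [EMetricSpace X] [MeasurableSpace X]
    [BorelSpace X] [EMetricSpace Y] [MeasurableSpace Y] [BorelSpace Y] (d : ℕ) {S : Set X}
    {f : X → Y} {L : ℝ≥0} (hf : ∀ x ∈ S, ∀ y ∈ S, edist x y ≤ L * edist (f x) (f y)) :
    Measure.euclideanHausdorffMeasure d S ≤
      (L : ℝ≥0∞) ^ d * Measure.euclideanHausdorffMeasure d (f '' S) := by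
  have h1 : AntilipschitzWith L (fun x : S => f x) := fun x y => hf x x.2 y y.2
  have h2 := h1.le_hausdorffMeasure_image (d := d) (by positivity) univ
  have h3 : (fun x : S => f x) '' univ = f '' S := by
    ext
    simp
  have h4 := (isometry_subtype_coe (s := S)).hausdorffMeasure_image (d := d)
    (Or.inl (by positivity)) univ
  rw [image_univ, Subtype.range_coe] at h4
  rw [h3, ← h4, ENNReal.rpow_natCast] at h2
  simp only [Measure.euclideanHausdorffMeasure_def, Measure.smul_apply, ENNReal.smul_def,
    smul_eq_mul]
  rw [mul_left_comm]
  gcongr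

end MeasureComparison

lemma finrank_tangent {n : ℕ} {x₀ : Space n} (hx₀ : x₀ ∈ unitSphere n) :
    Module.finrank ℝ (Submodule.span ℝ {x₀})ᗮ = n := by
  have h2 := (Submodule.span ℝ {x₀}).finrank_add_finrank_orthogonal
  rw [finrank_euclideanSpace_fin, finrank_span_singleton (ne_zero_of_mem_unitSphere hx₀)] at h2
  omega

/-- The volume of a cylinder over a subset of a hyperplane. -/
lemma volume_cylinder {n : ℕ} {x₀ : Space n} (hx₀ : x₀ ∈ unitSphere n) {Q : Set (Space n)}
    (hQ : Q ⊆ tangent x₀) (a b : ℝ) :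
    volume {y : Space n | ∃ p ∈ Q, ∃ r ∈ Ico a b, y = p + r • x₀} =
      Measure.euclideanHausdorffMeasure n Q * ENNReal.ofReal (b - a) := by
  set s := Submodule.span ℝ {x₀}
  have hx1 := norm_of_mem_unitSphere hx₀
  have hmp := s.measurePreserving_measurableEquivProd (0 : Space n)
  rw [InnerProductSpace.euclideanHausdorffMeasure_eq_volume] at hmp
  set ι := LinearIsometryEquiv.toSpanUnitSingleton (𝕜 := ℝ) x₀ hx1
  have hι : ∀ r : ℝ, ((ι r : s) : Space n) = r • x₀ := fun r => rfl
  set Q' : Set (sᗮ : Submodule ℝ (Space n)) := Subtype.val ⁻¹' Q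
  have hset : {y : Space n | ∃ p ∈ Q, ∃ r ∈ Ico a b, y = p + r • x₀} =
      (s.measurableEquivProd (0 : Space n)) ⁻¹' ((ι '' Ico a b) ×ˢ Q') := by
    rw [← MeasurableEquiv.image_symm]
    ext y
    constructor
    · rintro ⟨p, hp, r, hr, rfl⟩
      refine ⟨(ι r, ⟨p, hQ hp⟩), ⟨⟨r, hr, rfl⟩, hp⟩, ?_⟩
      simp [hι, add_comm]
    · rintro ⟨⟨_, p⟩, ⟨⟨r, hr, rfl⟩, hp⟩, rfl⟩
      refine ⟨p, hp, r, hr, ?_⟩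
      simp [hι, add_comm]
  rw [hset, hmp.measure_preimage_equiv, Measure.volume_eq_prod, Measure.prod_prod, mul_comm]
  congr 1
  · rw [← InnerProductSpace.euclideanHausdorffMeasure_eq_volume, finrank_tangent hx₀,
      ← isometry_subtype_coe.euclideanHausdorffMeasure_image]
    congr 1
    ext y
    constructor
    · rintro ⟨p, hp, rfl⟩
      exact hp
    · intro hy
      exact ⟨⟨y, hQ hy⟩, hy, rfl⟩
  · have h1 : ι '' Ico a b = ι.symm ⁻¹' Ico a b := ι.toEquiv.image_eq_preimage_symm _
    rw [h1, ι.symm.measurePreserving.measure_preimage_emb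
      ι.symm.toHomeomorph.measurableEmbedding, Real.volume_Ico]

/-- The part of the cone over `E ⊆ 𝕊^n` with `1 ≤ ‖y‖ < 1 + δ`. -/
def sector {n : ℕ} (E : Set (unitSphere n)) (δ : ℝ) : Set (Space n) :=
  {y | ∃ θ ∈ E, ∃ r ∈ Ico 1 (1 + δ), y = r • (θ : Space n)}

/-- The sector is the difference of two truncated cones over E, of radii 1 + δ and 1. -/
lemma volume_sector {n : ℕ} {E : Set (unitSphere n)} (hE : MeasurableSet E) {δ : ℝ} (hδ : 0 < δ) :
    volume (sector E δ) =
      sphereMeasure n E * ENNReal.ofReal (((1 + δ) ^ (n + 1) - 1) / (n + 1)) := by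
  set G : Space n → ℝ≥0∞ := (Subtype.val '' E).indicator 1
  have hEm : MeasurableSet ((Subtype.val : unitSphere n → Space n) '' E) :=
    (MeasurableEmbedding.subtype_coe Metric.isClosed_sphere.measurableSet).measurableSet_image.2 hE
  have hG : Measurable fun θ : unitSphere n => G θ :=
    (measurable_one.indicator hEm).comp measurable_subtype_coe
  have hG' : ∀ θ : unitSphere n, G θ = E.indicator 1 θ := by
    intro θ
    by_cases hθ : θ ∈ E
    · rw [indicator_of_mem hθ]
      exact indicator_of_mem (mem_image_of_mem _ hθ) _
    · rw [indicator_of_notMem hθ]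
      exact indicator_of_notMem (fun hh => hθ (by simpa using hh)) _
  have hball : ∀ ρ : ℝ, 0 < ρ →
      volume {y : Space n | y ≠ 0 ∧ ‖y‖ < ρ ∧ ‖y‖⁻¹ • y ∈ Subtype.val '' E} =
        sphereMeasure n E * ENNReal.ofReal (ρ ^ (n + 1) / (n + 1)) := by
    intro ρ hρ
    have h1 := setLIntegral_radial (n := n) (k := fun _ => ρ) (G := G) measurable_const hG
      (fun _ _ => hρ)
    have hm1 : MeasurableSet {y : Space n | ‖y‖⁻¹ • y ∈ (Subtype.val : unitSphere n → Space n) '' E} :=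
      (measurable_norm.inv.smul measurable_id) hEm
    have hm2 : MeasurableSet {y : Space n | y ≠ 0 ∧ ‖y‖ < ρ} :=
      measurableSet_radial (k := fun _ => ρ) measurable_const
    have h2 : ∫⁻ y in {y : Space n | y ≠ 0 ∧ ‖y‖ < ρ}, G (‖y‖⁻¹ • y) =
        volume ({y : Space n | ‖y‖⁻¹ • y ∈ (Subtype.val : unitSphere n → Space n) '' E} ∩
          {y : Space n | y ≠ 0 ∧ ‖y‖ < ρ}) := by
      rw [← Measure.restrict_apply hm1, ← lintegral_indicator_one hm1]
      rfl
    have h3 : {y : Space n | y ≠ 0 ∧ ‖y‖ < ρ ∧ ‖y‖⁻¹ • y ∈ Subtype.val '' E} =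
        {y : Space n | ‖y‖⁻¹ • y ∈ (Subtype.val : unitSphere n → Space n) '' E} ∩
          {y : Space n | y ≠ 0 ∧ ‖y‖ < ρ} := by
      ext y
      simp only [mem_ofPred_eq, mem_inter_iff]
      tauto
    rw [h3, ← h2, h1]
    simp_rw [hG']
    rw [lintegral_mul_const _ (measurable_one.indicator hE), lintegral_indicator_one hE]
  have hfin : ∀ ρ : ℝ, 0 < ρ →
      volume {y : Space n | y ≠ 0 ∧ ‖y‖ < ρ ∧ ‖y‖⁻¹ • y ∈ Subtype.val '' E} ≠ ⊤ := by
    intro ρ hρ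
    rw [hball ρ hρ]
    exact ENNReal.mul_ne_top (measure_ne_top _ _) ENNReal.ofReal_ne_top
  have hmeas : MeasurableSet {y : Space n | y ≠ 0 ∧ ‖y‖ < 1 ∧ ‖y‖⁻¹ • y ∈ Subtype.val '' E} := by
    refine (measurableSet_singleton (0 : Space n)).compl.inter
      ((measurableSet_lt measurable_norm measurable_const).inter ?_)
    exact (measurable_norm.inv.smul measurable_id) hEm
  have hsec : sector E δ =
      {y : Space n | y ≠ 0 ∧ ‖y‖ < 1 + δ ∧ ‖y‖⁻¹ • y ∈ Subtype.val '' E} \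
        {y : Space n | y ≠ 0 ∧ ‖y‖ < 1 ∧ ‖y‖⁻¹ • y ∈ Subtype.val '' E} := by
    ext y
    constructor
    · rintro ⟨θ, hθ, r, hr, rfl⟩
      have hr0 : 0 < r := lt_of_lt_of_le one_pos hr.1
      have hn : ‖r • (θ : Space n)‖ = r := by
        rw [norm_smul, norm_of_mem_unitSphere θ.2, mul_one, Real.norm_of_nonneg hr0.le]
      simp only [Set.mem_sdiff, mem_ofPred_eq, hn]
      refine ⟨⟨smul_ne_zero hr0.ne' (ne_zero_of_mem_unitSphere θ.2), hr.2, θ, hθ, ?_⟩, fun hh => ?_⟩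
      · rw [inv_smul_smul₀ hr0.ne']
      · exact absurd hh.2.1 (not_lt.2 hr.1)
    · rintro ⟨⟨hy0, hy1, θ, hθ, heq⟩, hy2⟩
      refine ⟨θ, hθ, ‖y‖, ⟨?_, hy1⟩, ?_⟩
      · by_contra hcon
        exact hy2 ⟨hy0, not_le.1 hcon, θ, hθ, heq⟩
      · rw [heq, smul_inv_smul₀ (norm_ne_zero_iff.2 hy0)]
  rw [hsec, measure_sdiff _ hmeas.nullMeasurableSet (hfin 1 one_pos), hball _ (by linarith),
    hball 1 one_pos, ← ENNReal.mul_sub (fun _ _ => measure_ne_top _ _),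
    ← ENNReal.ofReal_sub _ (by positivity), one_pow, sub_div]
  rintro y ⟨hy0, hy1, hy2⟩
  exact ⟨hy0, hy1.trans (by linarith), hy2⟩

lemma le_sector_factor (n : ℕ) {δ : ℝ} (hδ : 0 < δ) :
    δ ≤ ((1 + δ) ^ (n + 1) - 1) / (n + 1) := by
  rw [le_div_iff₀ (by positivity)]
  have := one_add_mul_le_pow (show (-2 : ℝ) ≤ δ by linarith) (n + 1)
  push_cast at this
  linarith

lemma sector_factor_le (n : ℕ) {δ : ℝ} (hδ : 0 < δ) :
    ((1 + δ) ^ (n + 1) - 1) / (n + 1) ≤ δ * (1 + δ) ^ n := by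
  rw [div_le_iff₀ (by positivity), ← mul_geom_sum, add_sub_cancel_left, mul_assoc]
  refine mul_le_mul_of_nonneg_left ?_ hδ.le
  refine (Finset.sum_le_card_nsmul _ _ ((1 + δ) ^ n) fun i hi => ?_).trans (le_of_eq ?_)
  · exact pow_le_pow_right₀ (by linarith) (Nat.lt_succ_iff.1 (Finset.mem_range.1 hi))
  · simp [mul_comm]

/-- The orthogonal projection to the hyperplane `x₀^⊥`, for a unit vector `x₀`. -/
noncomputable def hyperplaneProj {n : ℕ} (x₀ : Space n) : Space n →L[ℝ] Space n :=
  ContinuousLinearMap.id ℝ (Space n) - (innerSL ℝ x₀).smulRight x₀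

lemma hyperplaneProj_apply {n : ℕ} (x₀ v : Space n) :
    hyperplaneProj x₀ v = v - ⟪x₀, v⟫_ℝ • x₀ := by
  simp [hyperplaneProj]

lemma hyperplaneProj_mem {n : ℕ} {x₀ : Space n} (hx₀ : x₀ ∈ unitSphere n) (v : Space n) :
    hyperplaneProj x₀ v ∈ tangent x₀ := by
  rw [hyperplaneProj_apply, mem_tangent_iff, inner_sub_right, inner_smul_right,
    real_inner_self_eq_norm_sq, norm_of_mem_unitSphere hx₀]
  ring

lemma norm_hyperplaneProj_le {n : ℕ} {x₀ : Space n} (hx₀ : x₀ ∈ unitSphere n) (v : Space n) :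
    ‖hyperplaneProj x₀ v‖ ≤ ‖v‖ := by
  refine le_of_sq_le_sq ?_ (norm_nonneg _)
  rw [hyperplaneProj_apply, norm_sub_sq_real, inner_smul_right, norm_smul,
    norm_of_mem_unitSphere hx₀, real_inner_comm, Real.norm_eq_abs, mul_one, sq_abs]
  nlinarith [sq_nonneg ⟪x₀, v⟫_ℝ]

lemma norm_le_hyperplaneProj_add {n : ℕ} {x₀ : Space n} (hx₀ : x₀ ∈ unitSphere n) (v : Space n) :
    ‖v‖ ≤ ‖hyperplaneProj x₀ v‖ + |⟪x₀, v⟫_ℝ| := by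
  have h1 : v = hyperplaneProj x₀ v + ⟪x₀, v⟫_ℝ • x₀ := by
    rw [hyperplaneProj_apply, sub_add_cancel]
  have h2 := norm_add_le (hyperplaneProj x₀ v) (⟪x₀, v⟫_ℝ • x₀)
  rw [← h1, norm_smul, norm_of_mem_unitSphere hx₀, mul_one, Real.norm_eq_abs] at h2
  exact h2

/-- The flattened boundary parametrization near `x₀`, with the radial coordinate as height. -/
noncomputable def flattening {n : ℕ} (Ω : ConvexBody (Space n)) (x₀ y : Space n) : Space n :=
  hyperplaneProj x₀ (boundaryPt Ω y) + ‖y‖ • x₀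

namespace IsSmoothStrictlyConvex

variable {n : ℕ} {Ω : ConvexBody (Space n)} (h : IsSmoothStrictlyConvex Ω)
include h

/-- The derivative of X at x₀ already takes values in the hyperplane, so projecting does not change
it. The Jacobian of the flattening at x₀ is thus exactly D(x₀). -/
lemma hasStrictFDerivAt_flattening {x₀ : Space n} (hx₀ : x₀ ∈ unitSphere n) :
    HasStrictFDerivAt (flattening Ω x₀) (boundaryDeriv Ω x₀ + (innerSL ℝ x₀).smulRight x₀) x₀ := by
  have h0 := ne_zero_of_mem_unitSphere hx₀
  have h1 : HasStrictFDerivAt (fun y : Space n => ‖y‖) (innerSL ℝ x₀) x₀ := by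
    have h2 := (contDiffAt_norm ℝ (n := 1) h0).hasStrictFDerivAt one_ne_zero
    rwa [(hasFDerivAt_norm h0).fderiv, norm_of_mem_unitSphere hx₀, inv_one, one_smul] at h2
  have h2 : HasStrictFDerivAt (flattening Ω x₀)
      ((hyperplaneProj x₀).comp (boundaryDeriv Ω x₀) + (innerSL ℝ x₀).smulRight x₀) x₀ :=
    ((hyperplaneProj x₀).hasStrictFDerivAt.comp x₀ (h.hasStrictFDerivAt_boundaryPt h0)).add
      (h1.smul_const x₀)
  refine h2.congr_fderiv ?_
  ext1 w
  simp [hyperplaneProj_apply, h.inner_boundaryDeriv h0]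

/-- Near `x₀`, the boundary is nearly isometric to its projection to the tangent plane. -/
lemma exists_nhds_norm_sub_le {x₀ : Space n} (hx₀ : x₀ ∈ unitSphere n) {b : ℝ} (hb : 1 < b) :
    ∃ N ∈ 𝓝 x₀, ∀ x ∈ N ∩ unitSphere n, ∀ y ∈ N ∩ unitSphere n,
      ‖boundaryPt Ω x - boundaryPt Ω y‖ ≤
        b * ‖hyperplaneProj x₀ (boundaryPt Ω x) - hyperplaneProj x₀ (boundaryPt Ω y)‖ := by
  have h0 := ne_zero_of_mem_unitSphere hx₀
  set A := boundaryDeriv Ω x₀ + (innerSL ℝ x₀).smulRight x₀ with hA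
  have hdet : A.det ≠ 0 := by
    rw [hA, ← h.curvDet_eq hx₀]
    exact (h.curvDet_pos hx₀).ne'
  set e := A.toContinuousLinearEquivOfDetNeZero hdet
  obtain ⟨K, hK, hKA⟩ : ∃ K : ℝ, 0 < K ∧ ∀ w, ‖w‖ ≤ K * ‖A w‖ := by
    refine ⟨‖(e.symm : Space n →L[ℝ] Space n)‖ + 1, by positivity, fun w => ?_⟩
    have h1 := (e.symm : Space n →L[ℝ] Space n).le_opNorm (A w)
    have h2 : (e.symm : Space n →L[ℝ] Space n) (A w) = w := e.symm_apply_apply w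
    rw [h2] at h1
    nlinarith [norm_nonneg (A w)]
  have hΨ := (h.hasStrictFDerivAt_flattening hx₀).isLittleO.def
    (show 0 < (2 * K)⁻¹ by positivity)
  -- The height over the tangent plane has zero derivative at x₀. With K bounding the inverse of A,
  -- the flattening gives ‖x - y‖ ≤ 2K‖P‖ below, so the tolerance (b - 1)/(2K) bounds the height
  -- difference by (b - 1)‖P‖.
  have hg : HasStrictFDerivAt (fun y => ⟪x₀, boundaryPt Ω y⟫_ℝ)
      (0 : Space n →L[ℝ] ℝ) x₀ := by
    refine ((innerSL ℝ x₀).hasStrictFDerivAt.comp x₀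
      (h.hasStrictFDerivAt_boundaryPt h0)).congr_fderiv ?_
    ext1 w
    simp [h.inner_boundaryDeriv h0]
  have hη : 0 < (b - 1) * (2 * K)⁻¹ := mul_pos (by linarith) (by positivity)
  have hg' := hg.isLittleO.def hη
  have hev := hΨ.and hg'
  rw [nhds_prod_eq] at hev
  obtain ⟨N, hN, hNN⟩ := Filter.eventually_prod_self_iff'.1 hev
  refine ⟨N, hN, fun x hx y hy => ?_⟩
  obtain ⟨h1, h2⟩ := hNN x hx.1 y hy.1
  have h3 : flattening Ω x₀ x - flattening Ω x₀ y =
      hyperplaneProj x₀ (boundaryPt Ω x) - hyperplaneProj x₀ (boundaryPt Ω y) := by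
    simp only [flattening]
    rw [norm_of_mem_unitSphere hx.2, norm_of_mem_unitSphere hy.2]
    abel
  simp only [h3] at h1
  set P := hyperplaneProj x₀ (boundaryPt Ω x) - hyperplaneProj x₀ (boundaryPt Ω y) with hP
  have h4 : ‖A (x - y)‖ ≤ ‖P‖ + (2 * K)⁻¹ * ‖x - y‖ := by
    have h5 := norm_sub_le P (P - A (x - y))
    rw [sub_sub_cancel] at h5
    linarith
  have h5 : (2 * K)⁻¹ * ‖x - y‖ ≤ ‖P‖ := by
    have h6 := hKA (x - y)
    have h7 : ‖x - y‖ ≤ K * ‖P‖ + ‖x - y‖ / 2 := by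
      refine h6.trans ((mul_le_mul_of_nonneg_left h4 hK.le).trans (le_of_eq ?_))
      field_simp
    rw [inv_mul_le_iff₀ (by positivity)]
    linarith
  have h6 := norm_le_hyperplaneProj_add hx₀ (boundaryPt Ω x - boundaryPt Ω y)
  rw [map_sub, ← hP, inner_sub_right] at h6
  simp only [zero_apply, sub_zero, Real.norm_eq_abs] at h2
  rw [mul_assoc] at h2
  have h7 := mul_le_mul_of_nonneg_left h5 (show 0 ≤ b - 1 by linarith)
  linarith

lemma image_flattening_sector {x₀ : Space n} (E : Set (unitSphere n)) {δ : ℝ} :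
    flattening Ω x₀ '' sector E δ =
      {y : Space n | ∃ p ∈ (fun x => hyperplaneProj x₀ (boundaryPt Ω x)) '' (Subtype.val '' E),
        ∃ r ∈ Ico 1 (1 + δ), y = p + r • x₀} := by
  have key : ∀ θ : unitSphere n, ∀ r ∈ Ico 1 (1 + δ), flattening Ω x₀ (r • (θ : Space n)) =
      hyperplaneProj x₀ (boundaryPt Ω θ) + r • x₀ := by
    intro θ r hr
    have hr0 : 0 < r := lt_of_lt_of_le one_pos hr.1
    rw [flattening, h.boundaryPt_smul (ne_zero_of_mem_unitSphere θ.2) hr0, norm_smul,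
      norm_of_mem_unitSphere θ.2, mul_one, Real.norm_of_nonneg hr0.le]
  ext y
  constructor
  · rintro ⟨_, ⟨θ, hθ, r, hr, rfl⟩, rfl⟩
    exact ⟨_, ⟨θ, ⟨θ, hθ, rfl⟩, rfl⟩, r, hr, key θ r hr⟩
  · rintro ⟨_, ⟨_, ⟨θ, hθ, rfl⟩, rfl⟩, r, hr, rfl⟩
    exact ⟨_, ⟨θ, hθ, r, hr, rfl⟩, key θ r hr⟩

end IsSmoothStrictlyConvex

end GaussFlow

namespace GaussFlow

open Filter Topology
open scoped NNReal ENNReal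

namespace IsSmoothStrictlyConvex

variable {n : ℕ} {Ω : ConvexBody (Space n)} (h : IsSmoothStrictlyConvex Ω)
include h

/-- Near `x₀`, the surface measure of `∂Ω` is nearly `det A` times that of the sphere. -/
lemma exists_nhds_measure_compare (x₀ : unitSphere n) {b : ℝ≥0} (hb : 1 < b) :
    ∃ U ∈ 𝓝 x₀, ∀ E ⊆ U, MeasurableSet E →
      Measure.euclideanHausdorffMeasure n (boundaryPt Ω '' (Subtype.val '' E)) ≤
          (b : ℝ≥0∞) ^ (2 * n + 1) * (ENNReal.ofReal (curvDet Ω x₀) * sphereMeasure n E) ∧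
        ENNReal.ofReal (curvDet Ω x₀) * sphereMeasure n E ≤
          b * Measure.euclideanHausdorffMeasure n (boundaryPt Ω '' (Subtype.val '' E)) := by
  have hx₀ := x₀.2
  have hb' : (1 : ℝ) < b := hb
  have hb0 : b ≠ 0 := (zero_lt_one.trans hb).ne'
  have hD := h.curvDet_pos hx₀
  set D : ℝ≥0 := (curvDet Ω x₀).toNNReal with hDdef
  have hD0 : 0 < D := Real.toNNReal_pos.2 hD
  obtain ⟨N₁, hN₁, hlip⟩ := h.exists_nhds_norm_sub_le hx₀ hb'
  have hstrict := h.hasStrictFDerivAt_flattening hx₀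
  set A := boundaryDeriv Ω x₀ + (innerSL ℝ (x₀ : Space n)).smulRight (x₀ : Space n) with hA
  have hdet : ENNReal.ofReal |A.det| = D := by
    rw [hA, ← h.curvDet_eq hx₀, abs_of_pos hD]
    rfl
  have hup := addHaar_image_le_mul_of_det_lt volume A (m := b * D) (by
    rw [hdet]
    exact_mod_cast lt_mul_of_one_lt_left hD0 hb)
  have hlo := mul_le_addHaar_image_of_lt_det volume A (m := b⁻¹ * D) (by
    rw [hdet]
    exact_mod_cast mul_lt_of_lt_one_left hD0 (inv_lt_one_of_one_lt₀ hb))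
  obtain ⟨c, ⟨hup, hlo⟩, hc⟩ := ((hup.and hlo).and self_mem_nhdsWithin).exists
  obtain ⟨N₂, hN₂, happ⟩ := hstrict.approximates_deriv_on_nhds (c := c) (Or.inr hc)
  have hcont : Tendsto (fun p : ℝ × unitSphere n => p.1 • (p.2 : Space n)) (𝓝 1 ×ˢ 𝓝 x₀)
      (𝓝 x₀) := by
    rw [← nhds_prod_eq]
    have : Continuous fun p : ℝ × unitSphere n => p.1 • (p.2 : Space n) := by fun_prop
    simpa using this.tendsto (1, x₀)
  have hpre := hcont (inter_mem hN₁ hN₂)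
  obtain ⟨I, hI, U, hU, hIU⟩ := Filter.mem_prod_iff.1 hpre
  obtain ⟨δ', hδ', hball⟩ := Metric.mem_nhds_iff.1 hI
  -- The condition 1 + δ ≤ b bounds the sector factor by δ b^n.
  obtain ⟨δ, hδ, hδ1, hδb⟩ : ∃ δ : ℝ, 0 < δ ∧ δ ≤ δ' ∧ 1 + δ ≤ b :=
    ⟨min δ' (b - 1), lt_min hδ' (by linarith), min_le_left _ _, by
      linarith [min_le_right δ' ((b : ℝ) - 1)]⟩
  have hmemI : ∀ r ∈ Ico 1 (1 + δ), r ∈ I := by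
    intro r hr
    apply hball
    rw [Metric.mem_ball, Real.dist_eq, abs_of_nonneg (by linarith [hr.1])]
    linarith [hr.2]
  refine ⟨U, hU, fun E hE hEm => ?_⟩
  have hsec : sector E δ ⊆ N₂ := by
    rintro _ ⟨θ, hθ, r, hr, rfl⟩
    exact (hIU (mk_mem_prod (hmemI r hr) (hE hθ))).2
  have hEN₁ : ∀ x ∈ Subtype.val '' E, x ∈ N₁ ∩ unitSphere n := by
    rintro _ ⟨θ, hθ, rfl⟩
    have := (hIU (mk_mem_prod (hmemI 1 ⟨le_rfl, by linarith⟩) (hE hθ))).1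
    simp only [one_smul] at this
    exact ⟨this, θ.2⟩
  set μ : Measure (Space n) := Measure.euclideanHausdorffMeasure n
  set XE := boundaryPt Ω '' (Subtype.val '' E) with hXE
  set Q := hyperplaneProj (x₀ : Space n) '' XE with hQ
  -- Since X is constant along rays, the flattening maps the sector onto a cylinder of height δ over
  -- the projected boundary piece. Comparing volumes and cancelling δ compares μ Q with D(x₀) times
  -- the measure of E.
  have hvol : volume (flattening Ω x₀ '' sector E δ) = μ Q * ENNReal.ofReal δ := by
    rw [h.image_flattening_sector, ← image_image, volume_cylinder hx₀, add_sub_cancel_left]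
    rintro _ ⟨v, -, rfl⟩
    exact hyperplaneProj_mem hx₀ v
  have happ' := happ.mono_set hsec
  have h1 := hup _ _ happ'
  have h2 := hlo _ _ happ'
  rw [hvol, volume_sector hEm hδ] at h1 h2
  have hδ0 : ENNReal.ofReal δ ≠ 0 := (ENNReal.ofReal_pos.2 hδ).ne'
  have hδt : ENNReal.ofReal δ ≠ ⊤ := ENNReal.ofReal_ne_top
  have hQup : μ Q ≤ (b : ℝ≥0∞) ^ (n + 1) * (D * sphereMeasure n E) := by
    rw [← ENNReal.mul_le_mul_iff_left hδ0 hδt]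
    refine h1.trans ?_
    have h3 : ENNReal.ofReal (((1 + δ) ^ (n + 1) - 1) / (n + 1)) ≤
        ENNReal.ofReal δ * (b : ℝ≥0∞) ^ n := by
      refine (ENNReal.ofReal_le_ofReal ((sector_factor_le n hδ).trans
        (mul_le_mul_of_nonneg_left (pow_le_pow_left₀ (by linarith) hδb n) hδ.le))).trans
        (le_of_eq ?_)
      rw [ENNReal.ofReal_mul hδ.le, ENNReal.ofReal_pow (by positivity), ENNReal.ofReal_coe_nnreal]
    calc ((b * D : ℝ≥0) : ℝ≥0∞) * (sphereMeasure n E *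
          ENNReal.ofReal (((1 + δ) ^ (n + 1) - 1) / (n + 1)))
        ≤ ((b * D : ℝ≥0) : ℝ≥0∞) * (sphereMeasure n E * (ENNReal.ofReal δ * (b : ℝ≥0∞) ^ n)) := by
          gcongr
      _ = _ := by
          push_cast
          ring
  have hQlo : (b : ℝ≥0∞)⁻¹ * (D * sphereMeasure n E) ≤ μ Q := by
    rw [← ENNReal.mul_le_mul_iff_left hδ0 hδt]
    refine le_trans ?_ h2
    have h3 := ENNReal.ofReal_le_ofReal (le_sector_factor n hδ)
    calc (b : ℝ≥0∞)⁻¹ * (D * sphereMeasure n E) * ENNReal.ofReal δ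
        = ((b⁻¹ * D : ℝ≥0) : ℝ≥0∞) * (sphereMeasure n E * ENNReal.ofReal δ) := by
          rw [ENNReal.coe_mul, ENNReal.coe_inv hb0]
          ring
      _ ≤ _ := by gcongr
  have hXQ : μ XE ≤ (b : ℝ≥0∞) ^ n * μ Q := by
    refine euclideanHausdorffMeasure_le_of_edist_le n ?_
    rintro _ ⟨x, hx, rfl⟩ _ ⟨y, hy, rfl⟩
    have h3 := hlip x (hEN₁ x hx) y (hEN₁ y hy)
    rw [← dist_eq_norm, ← dist_eq_norm] at h3
    rw [edist_nndist, edist_nndist, ← ENNReal.coe_mul, ENNReal.coe_le_coe]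
    exact_mod_cast h3
  have hQX : μ Q ≤ μ XE := by
    have h3 : LipschitzWith 1 (hyperplaneProj (x₀ : Space n)) := by
      refine LipschitzWith.of_dist_le_mul fun x y => ?_
      rw [dist_eq_norm, dist_eq_norm, ← map_sub, NNReal.coe_one, one_mul]
      exact norm_hyperplaneProj_le hx₀ _
    have h4 := h3.hausdorffMeasure_image_le (d := n) (by positivity) XE
    rw [ENNReal.coe_one, ENNReal.one_rpow, one_mul] at h4
    simp only [μ, Measure.euclideanHausdorffMeasure_def, Measure.smul_apply, ENNReal.smul_def,
      smul_eq_mul]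
    gcongr
  constructor
  -- Count of factors b: n from the projection, n from the sector and one from the Jacobian.
  · calc μ XE ≤ (b : ℝ≥0∞) ^ n * μ Q := hXQ
      _ ≤ (b : ℝ≥0∞) ^ n * ((b : ℝ≥0∞) ^ (n + 1) * (D * sphereMeasure n E)) := by gcongr
      _ = _ := by
        rw [← mul_assoc, ← pow_add]
        congr 2
        ring
  · have h3 := hQlo.trans hQX
    rwa [ENNReal.inv_mul_le_iff (by exact_mod_cast hb0) ENNReal.coe_ne_top] at h3

lemma measurableEmbedding_boundaryPt (hinj : InjOn (boundaryPt Ω) (unitSphere n)) :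
    MeasurableEmbedding fun θ : unitSphere n => boundaryPt Ω θ := by
  have hc : Continuous fun θ : unitSphere n => boundaryPt Ω θ :=
    continuousOn_iff_continuous_domRestrict.1 (h.contDiffOn_boundaryPt.continuousOn.mono
      fun _ hx => ne_zero_of_mem_unitSphere hx)
  exact (hc.isClosedEmbedding fun θ θ' heq => Subtype.ext (hinj θ.2 θ'.2 heq)).measurableEmbedding

/-- The area formula: `X` transports `det A dθ` to the surface measure of `∂Ω`. -/
lemma measure_boundaryPt_image (hinj : InjOn (boundaryPt Ω) (unitSphere n)) :
    (Measure.euclideanHausdorffMeasure n).comap (fun θ : unitSphere n => boundaryPt Ω θ) =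
      (sphereMeasure n).withDensity fun θ => ENNReal.ofReal (curvDet Ω θ) := by
  set μ : Measure (unitSphere n) :=
    (Measure.euclideanHausdorffMeasure n).comap (fun θ : unitSphere n => boundaryPt Ω θ)
  set ν : Measure (unitSphere n) :=
    (sphereMeasure n).withDensity fun θ => ENNReal.ofReal (curvDet Ω θ)
  have hemb := h.measurableEmbedding_boundaryPt hinj
  have hμ : ∀ E : Set (unitSphere n), MeasurableSet E → μ E =
      Measure.euclideanHausdorffMeasure n (boundaryPt Ω '' (Subtype.val '' E)) := by
    intro E hE
    rw [hemb.comap_apply, image_image]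
  -- Replacing the constant D(x₀) by the density D costs one more factor b, by continuity of D.
  have hloc : ∀ b : ℝ≥0, 1 < b → ∀ x₀ : unitSphere n, ∃ U ∈ 𝓝 x₀, ∀ E ⊆ U, MeasurableSet E →
      μ E ≤ (b : ℝ≥0∞) ^ (2 * n + 2) * ν E ∧ ν E ≤ (b : ℝ≥0∞) ^ 2 * μ E := by
    intro b hb x₀
    have hb0 : (0 : ℝ) < b := by exact_mod_cast zero_lt_one.trans hb
    have hb' : (1 : ℝ) < b := hb
    obtain ⟨U, hU, hcmp⟩ := h.exists_nhds_measure_compare x₀ hb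
    have hD := h.curvDet_pos x₀.2
    have hcont := h.continuous_curvDet_sphere.tendsto x₀
    have h1 := hcont.eventually (gt_mem_nhds (show curvDet Ω x₀ < b * curvDet Ω x₀ by nlinarith))
    have h2 := hcont.eventually
      (lt_mem_nhds (show (b : ℝ)⁻¹ * curvDet Ω x₀ < curvDet Ω x₀ from
        mul_lt_of_lt_one_left hD (inv_lt_one_of_one_lt₀ hb')))
    refine ⟨U ∩ {θ | curvDet Ω θ < b * curvDet Ω x₀ ∧ (b : ℝ)⁻¹ * curvDet Ω x₀ < curvDet Ω θ},
      inter_mem hU (h1.and h2), fun E hE hEm => ?_⟩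
    obtain ⟨h3, h4⟩ := hcmp E (hE.trans inter_subset_left) hEm
    rw [← hμ E hEm] at h3 h4
    have hup : ν E ≤ b * (ENNReal.ofReal (curvDet Ω x₀) * sphereMeasure n E) := by
      rw [withDensity_apply _ hEm, ← mul_assoc]
      refine (setLIntegral_mono measurable_const fun θ hθ => ?_).trans
        (setLIntegral_const E ((b : ℝ≥0∞) * ENNReal.ofReal (curvDet Ω x₀))).le
      rw [← ENNReal.ofReal_coe_nnreal, ← ENNReal.ofReal_mul hb0.le]
      exact ENNReal.ofReal_le_ofReal (hE hθ).2.1.le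
    have hlo : ENNReal.ofReal (curvDet Ω x₀) * sphereMeasure n E ≤ b * ν E := by
      rw [withDensity_apply _ hEm, ← setLIntegral_const, ← lintegral_const_mul _
        h.continuous_curvDet_sphere.measurable.ennreal_ofReal]
      refine setLIntegral_mono (h.continuous_curvDet_sphere.measurable.ennreal_ofReal.const_mul _)
        fun θ hθ => ?_
      rw [← ENNReal.ofReal_coe_nnreal, ← ENNReal.ofReal_mul hb0.le]
      refine ENNReal.ofReal_le_ofReal ?_
      have := (hE hθ).2.2
      rw [inv_mul_lt_iff₀ hb0] at this
      exact this.le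
    constructor
    · calc μ E ≤ _ := h3
        _ ≤ (b : ℝ≥0∞) ^ (2 * n + 1) * (b * ν E) := by gcongr
        _ = _ := by ring
    · calc ν E ≤ _ := hup
        _ ≤ b * (b * μ E) := by gcongr
        _ = _ := by ring
  have hroot : ∀ c : ℝ≥0, 1 < c → ∃ b : ℝ≥0, 1 < b ∧ b ^ (2 * n + 2) ≤ c := by
    intro c hc
    have h1 : Tendsto (fun b : ℝ≥0 => b ^ (2 * n + 2)) (𝓝[>] 1) (𝓝 (1 ^ (2 * n + 2))) :=
      ((continuous_pow _).tendsto 1).mono_left nhdsWithin_le_nhds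
    rw [one_pow] at h1
    obtain ⟨b, hb1, hb2⟩ := ((h1.eventually (gt_mem_nhds hc)).and self_mem_nhdsWithin).exists
    exact ⟨b, hb2, hb1.le⟩
  have hpow : ∀ c b : ℝ≥0, b ^ (2 * n + 2) ≤ c → (b : ℝ≥0∞) ^ (2 * n + 2) ≤ c := by
    intro c b hbc
    exact_mod_cast hbc
  ext E hE
  refine le_antisymm (le_of_forall_one_lt_le_mul fun c hc => ?_)
    (le_of_forall_one_lt_le_mul fun c hc => ?_)
  · obtain ⟨b, hb, hbc⟩ := hroot c hc
    refine measure_le_of_forall_nhds (fun x₀ => ?_) hE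
    obtain ⟨U, hU, hcmp⟩ := hloc b hb x₀
    exact ⟨U, hU, fun E hEU hEm => (hcmp E hEU hEm).1.trans
      (mul_le_mul_left (hpow c b hbc) _)⟩
  · obtain ⟨b, hb, hbc⟩ := hroot c hc
    refine measure_le_of_forall_nhds (fun x₀ => ?_) hE
    obtain ⟨U, hU, hcmp⟩ := hloc b hb x₀
    refine ⟨U, hU, fun E hEU hEm => (hcmp E hEU hEm).2.trans (mul_le_mul_left ?_ _)⟩
    refine le_trans ?_ (hpow c b hbc)
    exact pow_le_pow_right₀ (by exact_mod_cast hb.le) (by omega)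

end IsSmoothStrictlyConvex

end GaussFlow

namespace GaussFlow

open Filter Topology

/-! ### Gauss curvature and Chow's entropy in terms of the support function -/

namespace IsSmoothStrictlyConvex

variable {n : ℕ} {Ω : ConvexBody (Space n)} (h : IsSmoothStrictlyConvex Ω)
include h

variable {z : Space n} (hz : ∀ x ∈ unitSphere n, 0 < supportFn Ω z x)
include hz

lemma gaussMap_boundaryPt {x : Space n} (hx : x ∈ unitSphere n) :
    gaussMap Ω (boundaryPt Ω x) = x := by
  have hx0 := ne_zero_of_mem_unitSphere hx
  have h1 : IsOuterNormal Ω (boundaryPt Ω x) x := by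
    refine ⟨norm_of_mem_unitSphere hx, fun p hp => ?_⟩
    rw [h.inner_boundaryPt hx0]
    exact inner_le_supportFn_zero hp x
  have h2 : IsOuterNormal Ω (boundaryPt Ω x) (gaussMap Ω (boundaryPt Ω x)) :=
    Classical.epsilon_spec (p := IsOuterNormal Ω (boundaryPt Ω x)) ⟨x, h1⟩
  set y := gaussMap Ω (boundaryPt Ω x)
  have hy : y ∈ unitSphere n := by simpa using h2.1
  have hy0 := ne_zero_of_mem_unitSphere hy
  refine h.injOn_boundaryPt hz hy hx (h.eq_boundaryPt hy0 (h.boundaryPt_mem hx0) ?_).symm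
  refine le_antisymm (inner_le_supportFn_zero (h.boundaryPt_mem hx0) y) ?_
  rw [← h.inner_boundaryPt hy0]
  exact h2.2 _ (h.boundaryPt_mem hy0)

lemma continuousOn_gaussMap : ContinuousOn (gaussMap Ω) (frontier (Ω : Set (Space n))) := by
  rw [h.frontier_eq hz, continuousOn_iff_isClosed]
  intro t ht
  refine ⟨boundaryPt Ω '' (unitSphere n ∩ t), ?_, ?_⟩
  · have hc : ContinuousOn (boundaryPt Ω) (unitSphere n ∩ t) :=
      h.contDiffOn_boundaryPt.continuousOn.mono fun x hx => ne_zero_of_mem_unitSphere hx.1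
    exact (((isCompact_sphere (0 : Space n) 1).inter_right ht).image_of_continuousOn hc).isClosed
  · ext y
    constructor
    · rintro ⟨hy, x, hx, rfl⟩
      refine ⟨⟨x, ⟨hx, ?_⟩, rfl⟩, ⟨x, hx, rfl⟩⟩
      rwa [mem_preimage, h.gaussMap_boundaryPt hz hx] at hy
    · rintro ⟨⟨x, ⟨hx, hxt⟩, rfl⟩, -⟩
      refine ⟨?_, x, hx, rfl⟩
      rwa [mem_preimage, h.gaussMap_boundaryPt hz hx]

/-- The derivative of X kills the radial direction, so the inverse function argument uses the cone
map instead: it agrees with X on the sphere up to translation, has invertible derivative, and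
composed with ν is the identity on the boundary. -/
lemma differentiableWithinAt_gaussMap {x : Space n} (hx : x ∈ unitSphere n) :
    DifferentiableWithinAt ℝ (gaussMap Ω) (frontier (Ω : Set (Space n))) (boundaryPt Ω x) := by
  have hx0 := ne_zero_of_mem_unitSphere hx
  have hfr : boundaryPt Ω x ∈ frontier (Ω : Set (Space n)) := by
    rw [h.frontier_eq hz]
    exact mem_image_of_mem _ hx
  have hdet : (coneDeriv Ω z x).det ≠ 0 := by
    rw [h.det_coneDeriv z hx]
    exact (mul_pos (hz x hx) (h.curvDet_pos hx)).ne'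
  set e := (coneDeriv Ω z x).toContinuousLinearEquivOfDetNeZero hdet with he
  have hg := h.gaussMap_boundaryPt hz hx
  have hd : HasFDerivAt (fun p => ‖p‖ • (boundaryPt Ω p - z) + z) (e : Space n →L[ℝ] Space n)
      (gaussMap Ω (boundaryPt Ω x)) := by
    rw [hg]
    have h1 := (h.hasFDerivAt_cone z hx0).add_const z
    rw [norm_of_mem_unitSphere hx, inv_one, one_smul] at h1
    exact h1
  refine (HasFDerivWithinAt.of_local_left_inverse (t := univ) (by
    rw [nhdsWithin_univ]
    exact h.continuousOn_gaussMap hz _ hfr) hd.hasFDerivWithinAt hfr ?_).differentiableWithinAt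
  filter_upwards [self_mem_nhdsWithin] with y hy
  rw [h.frontier_eq hz] at hy
  obtain ⟨x', hx', rfl⟩ := hy
  rw [h.gaussMap_boundaryPt hz hx', norm_of_mem_unitSphere hx', one_smul, sub_add_cancel]

/-- Differentiate ν(X(c)) = c/‖c‖ at s = 0 along the line c(s) = x + s v. As v is orthogonal to x,
the normalization contributes nothing to first order. -/
lemma fderivWithin_gaussMap_boundaryDeriv {x : Space n} (hx : x ∈ unitSphere n) {v : Space n}
    (hv : v ∈ tangent x) :
    fderivWithin ℝ (gaussMap Ω) (frontier (Ω : Set (Space n))) (boundaryPt Ω x)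
      (boundaryDeriv Ω x v) = v := by
  have hx0 := ne_zero_of_mem_unitSphere hx
  have hxv : ⟪x, v⟫_ℝ = 0 := mem_tangent_iff.1 hv
  have hd := (h.differentiableWithinAt_gaussMap hz hx).hasFDerivWithinAt
  set c : ℝ → Space n := fun s => x + s • v with hcdef
  have hc0 : c 0 = x := by simp [hcdef]
  have hne : ∀ s, c s ≠ 0 := by
    intro s h0
    have h1 := congrArg (fun w => ⟪x, w⟫_ℝ) h0
    simp [hcdef, inner_add_right, inner_smul_right, hxv, norm_of_mem_unitSphere hx] at h1
  have hc : HasDerivAt c v 0 := by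
    simpa [hcdef] using ((hasDerivAt_id (0 : ℝ)).smul_const v).const_add x
  have h1 : HasDerivAt (fun s => boundaryPt Ω (c s)) (boundaryDeriv Ω x v) 0 :=
    HasFDerivAt.comp_hasDerivAt_of_eq 0 (h.hasFDerivAt_boundaryPt hx0) hc hc0.symm
  have hval : ∀ s, boundaryPt Ω (c s) = boundaryPt Ω (‖c s‖⁻¹ • c s) := fun s =>
    (h.boundaryPt_smul (hne s) (inv_pos.2 (norm_pos_iff.2 (hne s)))).symm
  have h2 : HasDerivAt (gaussMap Ω ∘ fun s => boundaryPt Ω (c s))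
      (fderivWithin ℝ (gaussMap Ω) (frontier (Ω : Set (Space n))) (boundaryPt Ω x)
        (boundaryDeriv Ω x v)) 0 := by
    rw [← hasDerivWithinAt_univ] at h1 ⊢
    refine HasFDerivWithinAt.comp_hasDerivWithinAt_of_eq 0 hd h1 ?_ (by simp [hc0])
    intro s _
    simp only [h.frontier_eq hz, hval]
    exact mem_image_of_mem _ (normalize_mem_unitSphere (hne s))
  have h3 : (gaussMap Ω ∘ fun s => boundaryPt Ω (c s)) = fun s => ‖c s‖⁻¹ • c s := by
    funext s
    simp only [Function.comp]
    rw [hval, h.gaussMap_boundaryPt hz (normalize_mem_unitSphere (hne s))]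
  rw [h3] at h2
  have h4 : HasDerivAt (fun s => ‖c s‖⁻¹) _ 0 :=
    HasFDerivAt.comp_hasDerivAt_of_eq (l := fun p : Space n => ‖p‖⁻¹) 0
      (hasFDerivAt_norm_inv hx0) hc hc0.symm
  have h5 := h2.unique (h4.smul hc)
  rw [h5]
  simp [hc0, norm_of_mem_unitSphere hx, hxv]

lemma gaussCurvature_boundaryPt {x : Space n} (hx : x ∈ unitSphere n) :
    gaussCurvature Ω (boundaryPt Ω x) = (curvDet Ω x)⁻¹ := by
  -- The Weingarten map acts on the tangent space at ν(X(x)), a type depending on this expression;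
  -- generalizing it to x' allows substitution by x.
  have key : ∀ x' : Space n, x = x' →
      ((tangent x').orthogonalProjectionOnto ∘L
        fderivWithin ℝ (gaussMap Ω) (frontier (Ω : Set (Space n))) (boundaryPt Ω x) ∘L
        (tangent x').subtypeL).det = (curvDet Ω x)⁻¹ := by
    rintro _ rfl
    set W := (tangent x).orthogonalProjectionOnto ∘L
        fderivWithin ℝ (gaussMap Ω) (frontier (Ω : Set (Space n))) (boundaryPt Ω x) ∘L
        (tangent x).subtypeL
    have h1 : W ∘L opA (supportFn Ω 0) x = ContinuousLinearMap.id ℝ (tangent x) := by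
      ext1 v
      simp only [W, ContinuousLinearMap.comp_apply, Submodule.subtypeL_apply, h.opA_apply hx,
        h.fderivWithin_gaussMap_boundaryDeriv hz hx v.2]
      exact Submodule.orthogonalProjectionOnto_mem_subspace_eq_self v
    have h2 : W.det * curvDet Ω x = 1 := by
      have h3 := congrArg ContinuousLinearMap.det h1
      simp only [ContinuousLinearMap.det] at h3
      rw [ContinuousLinearMap.toLinearMap_comp, LinearMap.det_comp] at h3
      simpa [ContinuousLinearMap.det, curvDet] using h3
    exact eq_inv_of_mul_eq_one_left h2
  exact key _ (h.gaussMap_boundaryPt hz hx).symm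

/-- Chow's entropy is the average of `-log det A` over the sphere. -/
lemma chowEntropy_eq :
    chowEntropy Ω =
      (sphereArea n)⁻¹ * ∫ θ : unitSphere n, -Real.log (curvDet Ω θ) ∂(sphereMeasure n) := by
  have hinj := h.injOn_boundaryPt hz
  have hemb := h.measurableEmbedding_boundaryPt hinj
  have hrange : range (fun θ : unitSphere n => boundaryPt Ω θ) = frontier (Ω : Set (Space n)) := by
    rw [h.frontier_eq hz, image_eq_range]
  rw [chowEntropy, ← hrange, ← hemb.map_comap, hemb.integral_map, h.measure_boundaryPt_image hinj,
    integral_withDensity_eq_integral_toReal_smul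
      h.continuous_curvDet_sphere.measurable.ennreal_ofReal
      (Eventually.of_forall fun _ => ENNReal.ofReal_lt_top)]
  congr 1
  refine integral_congr_ae (Eventually.of_forall fun θ => ?_)
  have hpos := h.curvDet_pos θ.2
  simp only [h.gaussCurvature_boundaryPt hz θ.2, ENNReal.toReal_ofReal hpos.le, smul_eq_mul,
    Real.log_inv]
  rw [mul_inv_cancel_left₀ hpos.ne']

end IsSmoothStrictlyConvex

end GaussFlow

namespace GaussFlow

open Filter Topology

/-! ### Integrals over the sphere depending on a parameter -/

section Parametric

variable {n : ℕ} {a b : ℝ}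

lemma continuousOn_slice {F : ℝ → unitSphere n → ℝ} {I : Set ℝ}
    (hF : ContinuousOn (Function.uncurry F) (I ×ˢ univ)) {t : ℝ} (ht : t ∈ I) : Continuous (F t) :=
  hF.comp_continuous (f := fun θ => (t, θ)) (by fun_prop) fun θ => ⟨ht, mem_univ θ⟩

lemma exists_bound_of_continuousOn {F : ℝ → unitSphere n → ℝ}
    (hF : ContinuousOn (Function.uncurry F) (Icc a b ×ˢ univ)) :
    ∃ C, ∀ t ∈ Icc a b, ∀ θ, ‖F t θ‖ ≤ C := by
  obtain ⟨C, hC⟩ := (isCompact_Icc.prod (isCompact_univ (X := unitSphere n))).exists_bound_of_continuousOn hF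
  exact ⟨C, fun t ht θ => hC (t, θ) ⟨ht, mem_univ θ⟩⟩

lemma continuousOn_integral_sphere {F : ℝ → unitSphere n → ℝ}
    (hF : ContinuousOn (Function.uncurry F) (Icc a b ×ˢ univ)) :
    ContinuousOn (fun t => ∫ θ, F t θ ∂(sphereMeasure n)) (Icc a b) := by
  obtain ⟨C, hC⟩ := exists_bound_of_continuousOn hF
  refine continuousOn_of_dominated (bound := fun _ => C)
    (fun t ht => (continuousOn_slice hF ht).aestronglyMeasurable)
    (fun t ht => Eventually.of_forall (hC t ht)) (integrable_const C)
    (Eventually.of_forall fun θ => ?_)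
  exact hF.comp (f := fun t => (t, θ)) (by fun_prop) fun t ht => ⟨ht, mem_univ θ⟩

/-- Dominated convergence for the difference quotients, which the mean value inequality bounds by
the maximum of |F'| on the compact product. -/
lemma hasDerivWithinAt_integral_sphere {F F' : ℝ → unitSphere n → ℝ}
    (hF : ContinuousOn (Function.uncurry F) (Icc a b ×ˢ univ))
    (hF' : ContinuousOn (Function.uncurry F') (Icc a b ×ˢ univ))
    (hd : ∀ t ∈ Icc a b, ∀ θ, HasDerivWithinAt (fun s => F s θ) (F' t θ) (Icc a b) t)
    {t : ℝ} (ht : t ∈ Icc a b) :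
    HasDerivWithinAt (fun s => ∫ θ, F s θ ∂(sphereMeasure n))
      (∫ θ, F' t θ ∂(sphereMeasure n)) (Icc a b) t := by
  obtain ⟨C, hC⟩ := exists_bound_of_continuousOn hF'
  have hint : ∀ s ∈ Icc a b, Integrable (F s) (sphereMeasure n) := fun s hs =>
    integrable_sphere_of_continuous (continuousOn_slice hF hs)
  rw [hasDerivWithinAt_iff_tendsto_slope]
  have hmem : ∀ᶠ s in 𝓝[Icc a b \ {t}] t, s ∈ Icc a b \ {t} := self_mem_nhdsWithin
  have hlim : Tendsto (fun s => ∫ θ, slope (fun r => F r θ) t s ∂(sphereMeasure n))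
      (𝓝[Icc a b \ {t}] t) (𝓝 (∫ θ, F' t θ ∂(sphereMeasure n))) := by
    refine tendsto_integral_filter_of_dominated_convergence (fun _ => C) ?_ ?_
      (integrable_const C) ?_
    · filter_upwards [hmem] with s hs
      simp only [slope_def_module]
      have hc : Continuous fun θ => (s - t)⁻¹ • (F s θ - F t θ) := by
        have h1 := continuousOn_slice hF hs.1
        have h2 := continuousOn_slice hF ht
        fun_prop
      exact hc.aestronglyMeasurable
    · filter_upwards [hmem] with s hs
      refine Eventually.of_forall fun θ => ?_
      have h1 := (convex_Icc a b).norm_image_sub_le_of_norm_hasDerivWithin_le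
        (fun r hr => hd r hr θ) (fun r hr => hC r hr θ) ht hs.1
      rw [slope_def_module, norm_smul, norm_inv]
      have h2 : 0 < ‖s - t‖ := norm_pos_iff.2 (sub_ne_zero.2 hs.2)
      rw [inv_mul_le_iff₀ h2, mul_comm]
      exact h1
    · exact Eventually.of_forall fun θ => (hasDerivWithinAt_iff_tendsto_slope.1 (hd t ht θ))
  refine hlim.congr' ?_
  filter_upwards [hmem] with s hs
  simp only [slope_def_module]
  rw [integral_smul, integral_sub (hint s hs.1) (hint t ht)]

end Parametric

/-! ### Volume identities and inequalities as integrals over the sphere -/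

lemma natCast_add_one_pos (n : ℕ) : (0 : ℝ) < (n : ℝ) + 1 := by positivity

lemma sphereArea_eq (n : ℕ) :
    sphereArea n = (n + 1) * (volume : Measure (Space n)).real (Metric.ball 0 1) := by
  rw [sphereArea, Measure.toSphere_real_apply_univ, finrank_euclideanSpace_fin]
  push_cast
  rfl

lemma sphereArea_pos (n : ℕ) : 0 < sphereArea n := by
  rw [sphereArea_eq]
  refine mul_pos (by positivity) (ENNReal.toReal_pos ?_ ?_)
  · exact (Metric.measure_ball_pos _ _ one_pos).ne'
  · exact measure_ball_lt_top.ne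

namespace IsSmoothStrictlyConvex

variable {n : ℕ} {Ω : ConvexBody (Space n)} (h : IsSmoothStrictlyConvex Ω)
  {z : Space n} (hz : ∀ x ∈ unitSphere n, 0 < supportFn Ω z x)
include h hz

lemma volume_real_eq : (n + 1) * (volume : Measure (Space n)).real Ω =
    ∫ θ : unitSphere n, supportFn Ω z θ * curvDet Ω θ ∂(sphereMeasure n) := by
  have hc := (h.continuous_supportFn_sphere z).mul h.continuous_curvDet_sphere
  have h0 : ∀ θ : unitSphere n, 0 < supportFn Ω z θ * curvDet Ω θ := fun θ =>
    mul_pos (hz θ θ.2) (h.curvDet_pos θ.2)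
  rw [Measure.real, h.volume_eq hz, ← integral_eq_lintegral_of_nonneg_ae, integral_const_mul]
  · field_simp
  · exact Eventually.of_forall fun θ => (mul_pos (by positivity) (h0 θ)).le
  · exact (hc.const_mul _).aestronglyMeasurable

/-- This is the cone comparison with k = u'_{z'} / u_z. It is an equality for Ω' = Ω and z' = z, and
only the support function of Ω' enters, not its curvature. -/
lemma volume_real_le {Ω' : ConvexBody (Space n)} {z' : Space n}
    (h' : IsSmoothStrictlyConvex Ω') (hz' : ∀ x ∈ unitSphere n, 0 < supportFn Ω' z' x) :
    (n + 1) * (volume : Measure (Space n)).real Ω' ≤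
      ∫ θ : unitSphere n, supportFn Ω' z' θ ^ (n + 1) *
        (curvDet Ω θ / supportFn Ω z θ ^ n) ∂(sphereMeasure n) := by
  have hc := h.continuous_supportFn_sphere z
  have hc' := h'.continuous_supportFn_sphere z'
  have hD := h.continuous_curvDet_sphere
  have h1 := h.volume_le_of_supportFn_le hz (Ω' := Ω') (z' := z')
    (k := fun x => supportFn Ω' z' x / supportFn Ω z x)
    (hc'.div hc fun θ => (hz θ θ.2).ne').measurable
    (fun θ hθ => div_pos (hz' θ hθ) (hz θ hθ))
    (fun θ hθ => by rw [div_mul_cancel₀ _ (hz θ hθ).ne'])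
  have h2 : ∀ θ : unitSphere n, (supportFn Ω' z' θ / supportFn Ω z θ) ^ (n + 1) / (n + 1) *
      (supportFn Ω z θ * curvDet Ω θ) = ((n : ℝ) + 1)⁻¹ * (supportFn Ω' z' θ ^ (n + 1) *
        (curvDet Ω θ / supportFn Ω z θ ^ n)) := by
    intro θ
    have := (hz θ θ.2).ne'
    rw [div_pow, pow_succ (supportFn Ω z θ)]
    field_simp
  simp_rw [h2] at h1
  have hcont : Continuous fun θ : unitSphere n => ((n : ℝ) + 1)⁻¹ * (supportFn Ω' z' θ ^ (n + 1) *
        (curvDet Ω θ / supportFn Ω z θ ^ n)) :=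
    ((hc'.pow _).mul (hD.div (hc.pow _) fun θ => (pow_pos (hz θ θ.2) n).ne')).const_mul _
  have h0 : ∀ θ : unitSphere n, 0 ≤ ((n : ℝ) + 1)⁻¹ * (supportFn Ω' z' θ ^ (n + 1) *
        (curvDet Ω θ / supportFn Ω z θ ^ n)) := fun θ => by
    have := hz θ θ.2
    have := hz' θ θ.2
    have := h.curvDet_pos θ.2
    positivity
  rw [← ofReal_integral_eq_lintegral_ofReal (integrable_sphere_of_continuous hcont)
    (Eventually.of_forall h0)] at h1
  have h3 := ENNReal.toReal_mono ENNReal.ofReal_ne_top h1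
  rw [ENNReal.toReal_ofReal (integral_nonneg h0), integral_const_mul] at h3
  have h4 := mul_le_mul_of_nonneg_left h3 (natCast_add_one_pos n).le
  rwa [mul_inv_cancel_left₀ (natCast_add_one_pos n).ne'] at h4

/-- If `Ω` is not larger than the unit ball, then `log u ≤ -log det A` on average. -/
lemma integral_log_supportFn_le
    (hvol : (n + 1) * (volume : Measure (Space n)).real Ω ≤ sphereArea n) :
    ∫ θ : unitSphere n, Real.log (supportFn Ω z θ) ∂(sphereMeasure n) ≤
      ∫ θ : unitSphere n, -Real.log (curvDet Ω θ) ∂(sphereMeasure n) := by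
  have hc := h.continuous_supportFn_sphere z
  have hD := h.continuous_curvDet_sphere
  have hl : Continuous fun θ : unitSphere n => Real.log (supportFn Ω z θ) :=
    hc.log fun θ => (hz θ θ.2).ne'
  have hlD : Continuous fun θ : unitSphere n => -Real.log (curvDet Ω θ) :=
    (hD.log fun θ => (h.curvDet_pos θ.2).ne').neg
  have hP : Continuous fun θ : unitSphere n => supportFn Ω z θ * curvDet Ω θ := hc.mul hD
  have hQ : Continuous fun θ : unitSphere n => supportFn Ω z θ * curvDet Ω θ - 1 :=
    hP.sub continuous_const
  have hR : Continuous fun θ : unitSphere n =>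
      -Real.log (curvDet Ω θ) + (supportFn Ω z θ * curvDet Ω θ - 1) := hlD.add hQ
  have h1 : ∀ θ : unitSphere n, Real.log (supportFn Ω z θ) ≤
      -Real.log (curvDet Ω θ) + (supportFn Ω z θ * curvDet Ω θ - 1) := by
    intro θ
    have h2 := Real.log_le_sub_one_of_pos (mul_pos (hz θ θ.2) (h.curvDet_pos θ.2))
    rw [Real.log_mul (hz θ θ.2).ne' (h.curvDet_pos θ.2).ne'] at h2
    linarith
  have h3 := integral_mono (integrable_sphere_of_continuous hl)
    (integrable_sphere_of_continuous hR) h1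
  rw [integral_add (integrable_sphere_of_continuous hlD)
    (integrable_sphere_of_continuous hQ),
    integral_sub (integrable_sphere_of_continuous hP) (integrable_const _),
    ← h.volume_real_eq hz, integral_const, smul_eq_mul, mul_one] at h3
  change _ ≤ _ + (_ - sphereArea n) at h3
  linarith

end IsSmoothStrictlyConvex

/-! ### The normalized flow -/

namespace IsNormalizedFlow

variable {n : ℕ} {T : EReal} {Ω : ℝ → ConvexBody (Space n)} (hf : IsNormalizedFlow T Ω)

lemma _root_.GaussFlow.Icc_subset_timeInterval {T : EReal} {τ : ℝ} (hτ : τ ∈ timeInterval T) :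
    Icc 0 τ ⊆ timeInterval T := fun _ ht =>
  ⟨ht.1, lt_of_le_of_lt (EReal.coe_le_coe_iff.2 ht.2) hτ.2⟩

lemma _root_.GaussFlow.uniqueDiffOn_timeInterval (T : EReal) : UniqueDiffOn ℝ (timeInterval T) := by
  intro t ht
  obtain ⟨τ, h1, h2⟩ := EReal.lt_iff_exists_real_btwn.1 ht.2
  have h1' : t < τ := EReal.coe_lt_coe_iff.1 h1
  have h3 : τ ∈ timeInterval T := ⟨ht.1.trans h1'.le, h2⟩
  exact (uniqueDiffOn_Icc (ht.1.trans_lt h1') t ⟨ht.1, h1'.le⟩).mono (Icc_subset_timeInterval h3)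

include hf

lemma isSmoothStrictlyConvex {t : ℝ} (ht : t ∈ timeInterval T) : IsSmoothStrictlyConvex (Ω t) where
  smooth := hf.smooth.comp (f := fun x : Space n => (t, x)) (by fun_prop) fun _ hx => ⟨ht, hx⟩
  pos := hf.convex t ht

lemma hasDerivWithinAt_supportFn {t : ℝ} (ht : t ∈ timeInterval T) (θ : unitSphere n) :
    HasDerivWithinAt (fun s => supportFn (Ω s) 0 θ)
      (supportFn (Ω t) 0 θ - (curvDet (Ω t) θ)⁻¹) (timeInterval T) t := by
  rw [← one_div]
  exact hf.evolution t ht θ θ.2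

lemma continuousOn_supportFn : ContinuousOn
    (Function.uncurry fun t (θ : unitSphere n) => supportFn (Ω t) 0 θ) (timeInterval T ×ˢ univ) :=
  hf.smooth.continuousOn.comp (f := fun p : ℝ × unitSphere n => (p.1, (p.2 : Space n)))
    (by fun_prop) fun p hp => ⟨hp.1, ne_zero_of_mem_unitSphere p.2.2⟩

/-- `det A` is jointly continuous, since `1 / det A = u - ∂u/∂t`. -/
lemma continuousOn_curvDet : ContinuousOn
    (Function.uncurry fun t (θ : unitSphere n) => curvDet (Ω t) θ) (timeInterval T ×ˢ univ) := by
  set S := timeInterval T ×ˢ ({0}ᶜ : Set (Space n))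
  set U : ℝ × Space n → ℝ := fun p => supportFn (Ω p.1) 0 p.2
  have hS : UniqueDiffOn ℝ S := (uniqueDiffOn_timeInterval T).prod isOpen_compl_singleton.uniqueDiffOn
  have hU' : ContinuousOn (fun p => fderivWithin ℝ U S p (1, 0)) S :=
    (hf.smooth.continuousOn_fderivWithin hS (by simp)).clm_apply continuousOn_const
  have hderiv : ∀ t ∈ timeInterval T, ∀ θ : unitSphere n,
      fderivWithin ℝ U S (t, (θ : Space n)) (1, 0) =
        supportFn (Ω t) 0 θ - (curvDet (Ω t) θ)⁻¹ := by
    intro t ht θ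
    have hmem : (t, (θ : Space n)) ∈ S := ⟨ht, ne_zero_of_mem_unitSphere θ.2⟩
    have h1 := (hf.smooth.differentiableOn (by simp) _ hmem).hasFDerivWithinAt
    have h2 : HasDerivWithinAt (fun s : ℝ => (s, (θ : Space n))) (1, 0) (timeInterval T) t :=
      (hasDerivWithinAt_id t _).prodMk (hasDerivWithinAt_const _ _ _)
    have h3 : HasDerivWithinAt (U ∘ fun s : ℝ => (s, (θ : Space n)))
        (fderivWithin ℝ U S (t, (θ : Space n)) (1, 0)) (timeInterval T) t :=
      h1.comp_hasDerivWithinAt t h2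
        (fun s hs => (⟨hs, ne_zero_of_mem_unitSphere θ.2⟩ : (s, (θ : Space n)) ∈ S))
    exact (uniqueDiffOn_timeInterval T t ht).eq_deriv _ h3 (hf.hasDerivWithinAt_supportFn ht θ)
  have hcomp : ContinuousOn (fun p : ℝ × unitSphere n =>
      fderivWithin ℝ U S (p.1, (p.2 : Space n)) (1, 0)) (timeInterval T ×ˢ univ) :=
    hU'.comp (f := fun p : ℝ × unitSphere n => (p.1, (p.2 : Space n)))
      (by fun_prop) fun p hp => ⟨hp.1, ne_zero_of_mem_unitSphere p.2.2⟩
  have hinv : ContinuousOn (fun p : ℝ × unitSphere n => (curvDet (Ω p.1) p.2)⁻¹)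
      (timeInterval T ×ˢ univ) := by
    refine (hf.continuousOn_supportFn.sub hcomp).congr fun p hp => ?_
    simp only [Pi.sub_apply, Function.uncurry]
    rw [hderiv p.1 hp.1 p.2, sub_sub_cancel]
  refine (hinv.inv₀ fun p hp => ?_).congr fun p hp => (inv_inv _).symm
  exact (inv_pos.2 ((hf.isSmoothStrictlyConvex hp.1).curvDet_pos p.2.2)).ne'

end IsNormalizedFlow

end GaussFlow

/-! ### Moving centres, the volume bound and the entropy along the flow -/

namespace GaussFlow

open Filter Topology

/-- A real supremum over an unbounded set is 0 by convention, so boundedness must be supplied; along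
the flow ℰ_C provides the bound. -/
lemma supportFn_le_entropy {n : ℕ} {Ω : ConvexBody (Space n)}
    {z : Space n} (hz : ∀ x ∈ unitSphere n, 0 < supportFn Ω z x)
    (hbdd : BddAbove {e : ℝ | ∃ z₀ ∈ Ω, (∀ x ∈ unitSphere n, 0 < supportFn Ω z₀ x) ∧
      e = (sphereArea n)⁻¹ * ∫ x, Real.log (supportFn Ω z₀ (x : Space n)) ∂(sphereMeasure n)}) :
    (sphereArea n)⁻¹ * ∫ x, Real.log (supportFn Ω z (x : Space n)) ∂(sphereMeasure n) ≤
      entropy Ω :=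
  le_csSup hbdd ⟨z, mem_of_supportFn_nonneg fun x hx => (hz x hx).le, hz, rfl⟩

namespace IsNormalizedFlow

variable {n : ℕ} {T : EReal} {Ω : ℝ → ConvexBody (Space n)} (hf : IsNormalizedFlow T Ω)
include hf

lemma hasDerivWithinAt_moving {t : ℝ} (ht : t ∈ timeInterval T) (τ : ℝ) (z : Space n)
    (θ : unitSphere n) :
    HasDerivWithinAt (fun s => supportFn (Ω s) (Real.exp (s - τ) • z) θ)
      (supportFn (Ω t) (Real.exp (t - τ) • z) θ - (curvDet (Ω t) θ)⁻¹) (timeInterval T) t := by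
  have h1 : (fun s => supportFn (Ω s) (Real.exp (s - τ) • z) θ) =
      fun s => supportFn (Ω s) 0 θ - Real.exp (s - τ) * ⟪(θ : Space n), z⟫_ℝ := by
    funext s
    rw [supportFn_eq_sub, inner_smul_right]
  have h2 : HasDerivAt (fun s => Real.exp (s - τ) * ⟪(θ : Space n), z⟫_ℝ)
      (Real.exp (t - τ) * ⟪(θ : Space n), z⟫_ℝ) t := by
    simpa using (((hasDerivAt_id t).sub_const τ).exp).mul_const ⟪(θ : Space n), z⟫_ℝ
  rw [h1]
  refine ((hf.hasDerivWithinAt_supportFn ht θ).sub h2.hasDerivWithinAt).congr_deriv ?_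
  rw [supportFn_eq_sub (Ω t) (Real.exp (t - τ) • z), inner_smul_right]
  ring

lemma continuousOn_moving (τ : ℝ) (z : Space n) : ContinuousOn
    (Function.uncurry fun t (θ : unitSphere n) => supportFn (Ω t) (Real.exp (t - τ) • z) θ)
    (timeInterval T ×ˢ univ) := by
  have h1 : (Function.uncurry fun t (θ : unitSphere n) =>
      supportFn (Ω t) (Real.exp (t - τ) • z) θ) = fun p =>
      (Function.uncurry fun t (θ : unitSphere n) => supportFn (Ω t) 0 θ) p -
        Real.exp (p.1 - τ) * ⟪(p.2 : Space n), z⟫_ℝ := by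
    funext p
    simp only [Function.uncurry]
    rw [supportFn_eq_sub, inner_smul_right]
  rw [h1]
  exact hf.continuousOn_supportFn.sub (by fun_prop)

/-- An admissible centre at time `τ`, transported backwards by the flow, stays admissible. -/
lemma supportFn_moving_pos {τ : ℝ} (hτ : τ ∈ timeInterval T) {z : Space n}
    (hz : ∀ x ∈ unitSphere n, 0 < supportFn (Ω τ) z x) {t : ℝ} (ht : t ∈ Icc 0 τ) :
    ∀ x ∈ unitSphere n, 0 < supportFn (Ω t) (Real.exp (t - τ) • z) x := by
  intro x hx
  -- The integrating factor e^{-s} removes the linear term and leaves the derivative -e^{-s}/D < 0.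
  set g : ℝ → ℝ := fun s => Real.exp (-s) * supportFn (Ω s) (Real.exp (s - τ) • z) x
  have hsub := Icc_subset_timeInterval hτ
  have hd : ∀ s ∈ Icc 0 τ, HasDerivWithinAt g (-(Real.exp (-s) * (curvDet (Ω s) x)⁻¹))
      (Icc 0 τ) s := by
    intro s hs
    have h1 : HasDerivAt (fun s => Real.exp (-s)) (-Real.exp (-s)) s := by
      simpa using (hasDerivAt_neg s).exp
    have h2 := (hf.hasDerivWithinAt_moving (hsub hs) τ z ⟨x, hx⟩).mono hsub
    refine (h1.hasDerivWithinAt.mul h2).congr_deriv ?_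
    simp only
    ring
  have hanti : AntitoneOn g (Icc 0 τ) := by
    refine antitoneOn_of_hasDerivWithinAt_nonpos (convex_Icc 0 τ)
      (fun s hs => (hd s hs).continuousWithinAt)
      (fun s hs => (hd s (interior_subset hs)).mono interior_subset) fun s hs => ?_
    have := (hf.isSmoothStrictlyConvex (hsub (interior_subset hs))).curvDet_pos hx
    have := Real.exp_pos (-s)
    rw [neg_nonpos]
    positivity
  have h1 := hanti ht ⟨ht.1.trans ht.2, le_rfl⟩ ht.2
  have h2 : 0 < g τ := by
    simp only [g, sub_self, Real.exp_zero, one_smul]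
    exact mul_pos (Real.exp_pos _) (hz x hx)
  exact pos_of_mul_pos_right (h2.trans_le h1) (Real.exp_pos _).le

/-- The volume stays below that of the unit ball. -/
lemma volume_le (hn : 1 ≤ n)
    (hvol : volume (Ω 0 : Set (Space n)) = volume (Metric.ball (0 : Space n) 1))
    {τ : ℝ} (hτ : τ ∈ timeInterval T) :
    (n + 1) * (volume : Measure (Space n)).real (Ω τ) ≤ sphereArea n := by
  obtain ⟨z, -, hz⟩ := (hf.isSmoothStrictlyConvex hτ).exists_supportFn_pos hn
  have hsub := Icc_subset_timeInterval hτ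
  have hτ0 : 0 ≤ τ := hτ.1
  have hpos : ∀ t ∈ Icc 0 τ, _ := fun t ht => hf.supportFn_moving_pos hτ hz ht
  have hS : ∀ t ∈ Icc 0 τ, IsSmoothStrictlyConvex (Ω t) := fun t ht =>
    hf.isSmoothStrictlyConvex (hsub ht)
  have hcv : ContinuousOn (Function.uncurry fun t (θ : unitSphere n) =>
      supportFn (Ω t) (Real.exp (t - τ) • z) θ) (Icc 0 τ ×ˢ univ) :=
    (hf.continuousOn_moving τ z).mono (prod_mono_left hsub)
  have hcD : ContinuousOn (Function.uncurry fun t (θ : unitSphere n) => curvDet (Ω t) θ)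
      (Icc 0 τ ×ˢ univ) :=
    hf.continuousOn_curvDet.mono (prod_mono_left hsub)
  set V : ℝ → ℝ := fun t => (n + 1) * (volume : Measure (Space n)).real (Ω t) - sphereArea n
    with hV
  have hVc : ContinuousOn V (Icc 0 τ) := by
    have hc : ContinuousOn (Function.uncurry fun t (θ : unitSphere n) =>
        supportFn (Ω t) (Real.exp (t - τ) • z) θ * curvDet (Ω t) θ) (Icc 0 τ ×ˢ univ) :=
      hcv.mul hcD
    refine ((continuousOn_integral_sphere hc).sub
      (continuousOn_const (c := sphereArea n))).congr fun t ht => ?_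
    simp only [hV]
    rw [(hS t ht).volume_real_eq (hpos t ht)]
    rfl
  have hV0 : V 0 ≤ 0 := by
    simp only [hV]
    rw [sphereArea_eq, Measure.real, Measure.real, hvol, sub_self]
  -- Gronwall's inequality needs only an upper bound on right difference quotients. The
  -- differentiable function H, with the weight w frozen at time t, satisfies V s - V t ≤ H s - H t
  -- and has derivative (n+1) V t at t.
  have hslope : ∀ t ∈ Ico 0 τ, ∀ r, (n + 1) * V t < r →
      ∃ᶠ s in 𝓝[>] t, (s - t)⁻¹ * (V s - V t) < r := by
    intro t ht r hr
    have ht' : t ∈ Icc 0 τ := ⟨ht.1, ht.2.le⟩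
    set w : unitSphere n → ℝ := fun θ =>
      curvDet (Ω t) θ / supportFn (Ω t) (Real.exp (t - τ) • z) θ ^ n with hw
    have hwc : Continuous w :=
      (hS t ht').continuous_curvDet_sphere.div
        (((hS t ht').continuous_supportFn_sphere _).pow n)
        fun θ => (pow_pos (hpos t ht' θ θ.2) n).ne'
    have hwc' : ContinuousOn (fun p : ℝ × unitSphere n => w p.2) (Icc 0 τ ×ˢ univ) :=
      (hwc.comp continuous_snd).continuousOn
    set H : ℝ → ℝ := fun s => ∫ θ : unitSphere n,
      supportFn (Ω s) (Real.exp (s - τ) • z) θ ^ (n + 1) * w θ ∂(sphereMeasure n) with hH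
    have hcDinv : ContinuousOn (fun p : ℝ × unitSphere n => (curvDet (Ω p.1) p.2)⁻¹)
        (Icc 0 τ ×ˢ univ) :=
      hcD.inv₀ fun p hp => ((hS p.1 hp.1).curvDet_pos p.2.2).ne'
    have hHd := hasDerivWithinAt_integral_sphere (n := n) (a := 0) (b := τ)
      (F := fun s θ => supportFn (Ω s) (Real.exp (s - τ) • z) θ ^ (n + 1) * w θ)
      (F' := fun s θ => ((n : ℝ) + 1) * supportFn (Ω s) (Real.exp (s - τ) • z) θ ^ n *
        (supportFn (Ω s) (Real.exp (s - τ) • z) θ - (curvDet (Ω s) θ)⁻¹) * w θ)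
      ((hcv.pow (n + 1)).mul hwc')
      (((continuousOn_const.mul (hcv.pow n)).mul (hcv.sub hcDinv)).mul hwc')
      (fun s hs θ => by
        have h1 := ((hf.hasDerivWithinAt_moving (hsub hs) τ z θ).mono hsub).pow (n + 1)
        simpa using h1.mul_const (w θ)) ht'
    have hHval : ∫ θ : unitSphere n, ((n : ℝ) + 1) *
        supportFn (Ω t) (Real.exp (t - τ) • z) θ ^ n *
        (supportFn (Ω t) (Real.exp (t - τ) • z) θ - (curvDet (Ω t) θ)⁻¹) * w θ
          ∂(sphereMeasure n) = (n + 1) * V t := by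
      have h1 : ∀ θ : unitSphere n, ((n : ℝ) + 1) *
          supportFn (Ω t) (Real.exp (t - τ) • z) θ ^ n *
          (supportFn (Ω t) (Real.exp (t - τ) • z) θ - (curvDet (Ω t) θ)⁻¹) * w θ =
          (n + 1) * (supportFn (Ω t) (Real.exp (t - τ) • z) θ * curvDet (Ω t) θ - 1) := by
        intro θ
        have h2 := (pow_pos (hpos t ht' θ θ.2) n).ne'
        have h3 := ((hS t ht').curvDet_pos θ.2).ne'
        simp only [hw]
        field_simp
      have hc : Continuous fun θ : unitSphere n =>
          supportFn (Ω t) (Real.exp (t - τ) • z) θ * curvDet (Ω t) θ :=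
        ((hS t ht').continuous_supportFn_sphere _).mul (hS t ht').continuous_curvDet_sphere
      simp_rw [h1]
      rw [integral_const_mul, integral_sub (integrable_sphere_of_continuous hc)
        (integrable_const _), ← (hS t ht').volume_real_eq (hpos t ht'), integral_const,
        smul_eq_mul, mul_one]
      rfl
    rw [hHval] at hHd
    have hHt : H t = (n + 1) * (volume : Measure (Space n)).real (Ω t) := by
      rw [(hS t ht').volume_real_eq (hpos t ht')]
      refine integral_congr_ae (Eventually.of_forall fun θ => ?_)
      have h2 := (pow_pos (hpos t ht' θ θ.2) n).ne'
      simp only [hw]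
      rw [pow_succ]
      field_simp
    have hle : ∀ s ∈ Icc 0 τ, V s - V t ≤ H s - H t := by
      intro s hs
      have h1 := (hS t ht').volume_real_le (hpos t ht') (hS s hs) (hpos s hs)
      simp only [hV]
      rw [hHt]
      linarith
    have hIoi : Icc 0 τ ∈ 𝓝[>] t :=
      mem_of_superset (Ioo_mem_nhdsGT ht.2) fun s hs => ⟨ht.1.trans hs.1.le, hs.2.le⟩
    have hHd' : HasDerivWithinAt H ((n + 1) * V t) (Ioi t) t := hHd.mono_of_mem_nhdsWithin hIoi
    rw [hasDerivWithinAt_iff_tendsto_slope' self_notMem_Ioi] at hHd'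
    refine Eventually.frequently ?_
    filter_upwards [hHd'.eventually (gt_mem_nhds hr), hIoi, self_mem_nhdsWithin] with s h1 h2 h3
    refine lt_of_le_of_lt ?_ h1
    rw [slope_def_module, smul_eq_mul]
    exact mul_le_mul_of_nonneg_left (hle s h2) (inv_nonneg.2 (sub_nonneg.2 (le_of_lt h3)))
  have hfin := le_gronwallBound_of_liminf_deriv_right_le (f' := fun t => (n + 1) * V t)
    (K := n + 1) (ε := 0) hVc hslope hV0 (fun t _ => by simp) τ ⟨hτ0, le_rfl⟩
  rw [gronwallBound_ε0_δ0] at hfin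
  simp only [hV] at hfin
  linarith

/-- The existence of an admissible centre matters here: the supremum of the empty set would be 0. -/
lemma entropy_le_of_forall (hn : 1 ≤ n) {t : ℝ} (ht : t ∈ timeInterval T) {c : ℝ}
    (hc : ∀ z, (∀ x ∈ unitSphere n, 0 < supportFn (Ω t) z x) →
      (sphereArea n)⁻¹ * ∫ x, Real.log (supportFn (Ω t) z (x : Space n)) ∂(sphereMeasure n) ≤ c) :
    entropy (Ω t) ≤ c := by
  obtain ⟨z, hz, hpos⟩ := (hf.isSmoothStrictlyConvex ht).exists_supportFn_pos hn
  refine csSup_le ⟨_, z, hz, hpos, rfl⟩ ?_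
  rintro _ ⟨z₀, -, hz₀, rfl⟩
  exact hc z₀ hz₀

lemma continuousOn_chowEntropy (hn : 1 ≤ n) {t₁ t₀ : ℝ} (ht₁ : t₁ ∈ timeInterval T)
    (ht₀ : t₀ ∈ timeInterval T) : ContinuousOn (fun t => chowEntropy (Ω t)) (Icc t₁ t₀) := by
  have hsub : Icc t₁ t₀ ⊆ timeInterval T :=
    (Icc_subset_Icc_left ht₁.1).trans (Icc_subset_timeInterval ht₀)
  have hc : ContinuousOn (Function.uncurry fun t (θ : unitSphere n) =>
      -Real.log (curvDet (Ω t) θ)) (Icc t₁ t₀ ×ˢ univ) :=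
    ((hf.continuousOn_curvDet.mono (prod_mono_left hsub)).log fun p hp =>
      ((hf.isSmoothStrictlyConvex (hsub hp.1)).curvDet_pos p.2.2).ne').neg
  refine ((continuousOn_const (c := (sphereArea n)⁻¹)).mul
    (continuousOn_integral_sphere hc)).congr fun t ht => ?_
  obtain ⟨z, -, hz⟩ := (hf.isSmoothStrictlyConvex (hsub ht)).exists_supportFn_pos hn
  exact (hf.isSmoothStrictlyConvex (hsub ht)).chowEntropy_eq hz

variable (hn : 1 ≤ n)
  (hvol : volume (Ω 0 : Set (Space n)) = volume (Metric.ball (0 : Space n) 1))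
include hn hvol

lemma average_log_le_chowEntropy {t : ℝ} (ht : t ∈ timeInterval T) {z : Space n}
    (hz : ∀ x ∈ unitSphere n, 0 < supportFn (Ω t) z x) :
    (sphereArea n)⁻¹ * ∫ x, Real.log (supportFn (Ω t) z (x : Space n)) ∂(sphereMeasure n) ≤
      chowEntropy (Ω t) := by
  rw [(hf.isSmoothStrictlyConvex ht).chowEntropy_eq hz]
  exact mul_le_mul_of_nonneg_left ((hf.isSmoothStrictlyConvex ht).integral_log_supportFn_le hz
    (hf.volume_le hn hvol ht)) (inv_nonneg.2 (sphereArea_pos n).le)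

lemma average_log_le_entropy {t : ℝ} (ht : t ∈ timeInterval T) {z : Space n}
    (hz : ∀ x ∈ unitSphere n, 0 < supportFn (Ω t) z x) :
    (sphereArea n)⁻¹ * ∫ x, Real.log (supportFn (Ω t) z (x : Space n)) ∂(sphereMeasure n) ≤
      entropy (Ω t) := by
  refine supportFn_le_entropy hz ⟨chowEntropy (Ω t), ?_⟩
  rintro _ ⟨z₀, -, hz₀, rfl⟩
  exact hf.average_log_le_chowEntropy hn hvol ht hz₀

lemma entropy_le_chowEntropy {t : ℝ} (ht : t ∈ timeInterval T) :
    entropy (Ω t) ≤ chowEntropy (Ω t) :=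
  hf.entropy_le_of_forall hn ht fun _ hz => hf.average_log_le_chowEntropy hn hvol ht hz

/-- The average of `log u` along the flow grows at most at the rate `ℰ - ℰ_C`. -/
lemma average_log_sub_le {t₁ t₀ : ℝ} (ht₁ : t₁ ∈ timeInterval T) (ht₀ : t₀ ∈ timeInterval T)
    (hle : t₁ ≤ t₀) {z : Space n} (hz : ∀ x ∈ unitSphere n, 0 < supportFn (Ω t₀) z x)
    {φ : ℝ → ℝ} (hφ : IntegrableOn φ (Icc t₁ t₀))
    (hφle : ∀ t ∈ Icc t₁ t₀, entropy (Ω t) - chowEntropy (Ω t) ≤ φ t) :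
    (sphereArea n)⁻¹ * (∫ x, Real.log (supportFn (Ω t₀) z (x : Space n)) ∂(sphereMeasure n)) -
      entropy (Ω t₁) ≤ ∫ t in t₁..t₀, φ t := by
  have hsub0 := Icc_subset_timeInterval ht₀
  have hsub' : Icc t₁ t₀ ⊆ Icc 0 t₀ := Icc_subset_Icc_left ht₁.1
  have hsub := hsub'.trans hsub0
  have hpos : ∀ t ∈ Icc t₁ t₀, ∀ x ∈ unitSphere n,
      0 < supportFn (Ω t) (Real.exp (t - t₀) • z) x := fun t ht =>
    hf.supportFn_moving_pos ht₀ hz (hsub' ht)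
  have hS : ∀ t ∈ Icc t₁ t₀, IsSmoothStrictlyConvex (Ω t) := fun t ht =>
    hf.isSmoothStrictlyConvex (hsub ht)
  have hcv : ContinuousOn (Function.uncurry fun t (θ : unitSphere n) =>
      supportFn (Ω t) (Real.exp (t - t₀) • z) θ) (Icc t₁ t₀ ×ˢ univ) :=
    (hf.continuousOn_moving t₀ z).mono (prod_mono_left hsub)
  have hcD : ContinuousOn (Function.uncurry fun t (θ : unitSphere n) => curvDet (Ω t) θ)
      (Icc t₁ t₀ ×ˢ univ) :=
    hf.continuousOn_curvDet.mono (prod_mono_left hsub)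
  have hD0 : ∀ p ∈ Icc t₁ t₀ ×ˢ (univ : Set (unitSphere n)), curvDet (Ω p.1) p.2 ≠ 0 :=
    fun p hp => ((hS p.1 hp.1).curvDet_pos p.2.2).ne'
  have hv0 : ∀ p ∈ Icc t₁ t₀ ×ˢ (univ : Set (unitSphere n)),
      supportFn (Ω p.1) (Real.exp (p.1 - t₀) • z) p.2 ≠ 0 :=
    fun p hp => (hpos p.1 hp.1 p.2 p.2.2).ne'
  set ℓ : ℝ → ℝ := fun t => (sphereArea n)⁻¹ *
    ∫ θ : unitSphere n, Real.log (supportFn (Ω t) (Real.exp (t - t₀) • z) θ) ∂(sphereMeasure n)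
    with hℓ
  set F' : ℝ → unitSphere n → ℝ := fun t θ =>
    (supportFn (Ω t) (Real.exp (t - t₀) • z) θ - (curvDet (Ω t) θ)⁻¹) /
      supportFn (Ω t) (Real.exp (t - t₀) • z) θ with hF'
  have hclog : ContinuousOn (Function.uncurry fun t (θ : unitSphere n) =>
      Real.log (supportFn (Ω t) (Real.exp (t - t₀) • z) θ)) (Icc t₁ t₀ ×ˢ univ) :=
    hcv.log hv0
  have hcF' : ContinuousOn (Function.uncurry F') (Icc t₁ t₀ ×ˢ univ) :=
    (hcv.sub (hcD.inv₀ hD0)).div hcv hv0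
  have hd : ∀ t ∈ Icc t₁ t₀, HasDerivWithinAt ℓ
      ((sphereArea n)⁻¹ * ∫ θ, F' t θ ∂(sphereMeasure n)) (Icc t₁ t₀) t := by
    intro t ht
    refine (hasDerivWithinAt_integral_sphere hclog hcF' (fun s hs θ => ?_) ht).const_mul _
    exact ((hf.hasDerivWithinAt_moving (hsub hs) t₀ z θ).mono hsub).log (hpos s hs θ θ.2).ne'
  have hrate : ∀ t ∈ Icc t₁ t₀, (sphereArea n)⁻¹ * ∫ θ, F' t θ ∂(sphereMeasure n) ≤ φ t := by
    intro t ht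
    refine le_trans ?_ (hφle t ht)
    have hlog : Continuous fun θ : unitSphere n =>
        Real.log (supportFn (Ω t) (Real.exp (t - t₀) • z) θ) :=
      ((hS t ht).continuous_supportFn_sphere _).log fun θ => (hpos t ht θ θ.2).ne'
    have hlogD : Continuous fun θ : unitSphere n => -Real.log (curvDet (Ω t) θ) :=
      ((hS t ht).continuous_curvDet_sphere.log fun θ => ((hS t ht).curvDet_pos θ.2).ne').neg
    have hsubc : Continuous fun θ : unitSphere n =>
        Real.log (supportFn (Ω t) (Real.exp (t - t₀) • z) θ) - -Real.log (curvDet (Ω t) θ) :=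
      hlog.sub hlogD
    have h1 : ∫ θ, F' t θ ∂(sphereMeasure n) ≤ ∫ θ : unitSphere n,
        (Real.log (supportFn (Ω t) (Real.exp (t - t₀) • z) θ) - -Real.log (curvDet (Ω t) θ))
          ∂(sphereMeasure n) := by
      refine integral_mono (integrable_sphere_of_continuous (continuousOn_slice hcF' ht))
        (integrable_sphere_of_continuous hsubc) fun θ => ?_
      have hv := hpos t ht θ θ.2
      have hD := (hS t ht).curvDet_pos θ.2
      -- The integrand of the derivative is 1 - 1/(vD), and 1 - 1/s ≤ log s turns it into log v +
      -- log D.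
      have h2 := Real.one_sub_inv_le_log_of_pos (mul_pos hv hD)
      rw [Real.log_mul hv.ne' hD.ne'] at h2
      simp only [hF']
      rw [sub_neg_eq_add]
      refine le_trans (le_of_eq ?_) h2
      field_simp
    rw [integral_sub (integrable_sphere_of_continuous hlog)
      (integrable_sphere_of_continuous hlogD)] at h1
    have h2 := mul_le_mul_of_nonneg_left h1 (inv_nonneg.2 (sphereArea_pos n).le)
    rw [mul_sub, ← (hS t ht).chowEntropy_eq (hpos t ht)] at h2
    have h3 := hf.average_log_le_entropy hn hvol (hsub ht) (hpos t ht)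
    linarith
  have h1 := intervalIntegral.sub_le_integral_of_hasDeriv_right_of_le hle
    (fun t ht => (hd t ht).continuousWithinAt)
    (fun t ht => (hd t ⟨ht.1.le, ht.2.le⟩).mono_of_mem_nhdsWithin
      (mem_of_superset (Ioo_mem_nhdsGT ht.2) fun s hs => ⟨ht.1.le.trans hs.1.le, hs.2.le⟩))
    hφ (fun t ht => hrate t ⟨ht.1.le, ht.2.le⟩)
  have h2 := hf.average_log_le_entropy hn hvol ht₁ (hpos t₁ ⟨le_rfl, hle⟩)
  have h3 : ℓ t₀ = (sphereArea n)⁻¹ *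
      ∫ x, Real.log (supportFn (Ω t₀) z (x : Space n)) ∂(sphereMeasure n) := by
    simp only [hℓ, sub_self, Real.exp_zero, one_smul]
  rw [← h3]
  linarith

/-- Monotonicity uses the growth estimate with the majorant φ = 0. It has to come before the sharp
estimate, since measurability of t ↦ ℰ(Ω_t) is deduced from it. -/
lemma antitoneOn_entropy : AntitoneOn (fun t => entropy (Ω t)) (timeInterval T) := by
  intro t₁ ht₁ t₀ ht₀ hle
  refine hf.entropy_le_of_forall hn ht₀ fun z hz => ?_
  have h1 := hf.average_log_sub_le hn hvol ht₁ ht₀ hle hz (φ := fun _ => 0) integrableOn_zero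
    fun t ht => sub_nonpos.2 (hf.entropy_le_chowEntropy hn hvol
      (Icc_subset_timeInterval ht₀ ⟨ht₁.1.trans ht.1, ht.2⟩))
  rw [intervalIntegral.integral_zero] at h1
  linarith

end IsNormalizedFlow

end GaussFlow

theorem mainTheorem2 (n : ℕ) (hn : 1 ≤ n) (T : EReal)
    (Ω : ℝ → ConvexBody (GaussFlow.Space n))
    (hflow : GaussFlow.IsNormalizedFlow T Ω)
    (hvol : volume (Ω 0 : Set (GaussFlow.Space n)) =
      volume (Metric.ball (0 : GaussFlow.Space n) 1)) :
    AntitoneOn (fun t => GaussFlow.entropy (Ω t)) (GaussFlow.timeInterval T) ∧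
    ∀ t₁ ∈ GaussFlow.timeInterval T, ∀ t₀ ∈ GaussFlow.timeInterval T, t₁ ≤ t₀ →
      IntervalIntegrable
        (fun t => GaussFlow.entropy (Ω t) - GaussFlow.chowEntropy (Ω t)) volume t₁ t₀ ∧
      GaussFlow.entropy (Ω t₀) - GaussFlow.entropy (Ω t₁) ≤
        ∫ t in t₁..t₀, (GaussFlow.entropy (Ω t) - GaussFlow.chowEntropy (Ω t)) ∧
      ∫ t in t₁..t₀, (GaussFlow.entropy (Ω t) - GaussFlow.chowEntropy (Ω t)) ≤ 0 := by
  have hanti := hflow.antitoneOn_entropy hn hvol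
  refine ⟨hanti, fun t₁ ht₁ t₀ ht₀ hle => ?_⟩
  have hsub : Icc t₁ t₀ ⊆ GaussFlow.timeInterval T :=
    (Icc_subset_Icc_left ht₁.1).trans (GaussFlow.Icc_subset_timeInterval ht₀)
  have hint : IntervalIntegrable
      (fun t => GaussFlow.entropy (Ω t) - GaussFlow.chowEntropy (Ω t)) volume t₁ t₀ := by
    -- ℰ is integrable because it is monotone, ℰ_C because it is continuous in t.
    refine IntervalIntegrable.sub (AntitoneOn.intervalIntegrable ?_)
      (ContinuousOn.intervalIntegrable ?_)
    · rw [uIcc_of_le hle]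
      exact hanti.mono hsub
    · rw [uIcc_of_le hle]
      exact hflow.continuousOn_chowEntropy hn ht₁ ht₀
  refine ⟨hint, ?_, ?_⟩
  · rw [sub_le_iff_le_add]
    refine hflow.entropy_le_of_forall hn ht₀ fun z hz => ?_
    have h1 := hflow.average_log_sub_le hn hvol ht₁ ht₀ hle hz
      ((intervalIntegrable_iff_integrableOn_Icc_of_le hle).1 hint) fun t _ => le_rfl
    linarith
  · refine (intervalIntegral.integral_mono_on hle hint
      (intervalIntegrable_const (c := (0 : ℝ))) fun t ht => ?_).trans_eq (by simp)
    exact sub_nonpos.2 (hflow.entropy_le_chowEntropy hn hvol (hsub ht))
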